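/- Let $d\ge1$, let $|A|$ denote the Lebesgue measure of $A\subset\mathbb R^d$, and let "ball" mean closed ball of positive radius in $\mathbb R^d$. **Setting.** Let $f$ be a probability density on $\mathbb R^d$ that is everywhere positive, continuously differentiable and in $L^2(\mathbb R^d)$, and put $\mathcal L(g)=\int(g-f)^2\,d\lambda$. Let $(g_t)_{t>0}$ be a Wasserstein gradient flow of $\mathcal L$: an absolutely continuous curve of probability densities with finite second moment (that is, narrowly continuous in $t$, solving the continuity equation below with $\int_a^b\big(\int\|v_t\|^2g_t\,d\lambda\big)^{1/2}dt<\infty$ for all $0<a<b<\infty$) such that $$\partial_t g_t+\nabla\cdot(v_tg_t)=0\ \text{ on }(0,\infty)\times\mathbb R^d\text{ in the sense of distributions},\qquad v_t=-\nabla\Big(\frac{\delta\mathcal L}{\delta\nu}(g_t)\Big),$$ where the first variation $u=\frac{\delta\mathcal L}{\delta\nu}(g)$ is a differentiable function with $\frac{d}{ds}\mathcal L(g+s\psi)|_{s=0}=\int u\,\psi\,d\lambda$ for all $\psi\in C_c^\infty(\mathbb R^d)$ with $\int\psi\,d\lambda=0$. Assume that each $g_t$ is everywhere positive, differentiable and in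 $L^2(\mathbb R^d)$, and that $(t,x)\mapsto g_t(x)$ and $(t,x)\mapsto\nabla g_t(x)$ are continuous on $(0,\infty)\times\mathbb R^d$. **Assumption 1** (with parameters $K\in\mathbb N$, $\varepsilon_0\in(0,1)$, $c,M_1,M_2>0$). For every $\varepsilon\in(0,\varepsilon_0]$ there are pairwise disjoint balls $Q_1^\varepsilon,\dots,Q_K^\varepsilon$, with union $Q^\varepsilon$, such that for all $i$: (a) $\inf_{Q_i^\varepsilon}f\le\varepsilon^{1/4}$ and $\int_{Q^\varepsilon}f\,d\lambda\ge1-\varepsilon^{1/4}$; (b) $\displaystyle\sup_{Q\subset Q_i^\varepsilon,\ Q\text{ a ball}}|Q|^{2/d}\Big[\frac1{|Q|}\int_Qf^{-2}\,d\lambda\Big]^{1/2}\le M_1\,\varepsilon^{-1/4}[\log(1/\varepsilon)]^c$; (c) $\displaystyle\int_{Q_i^\varepsilon}\big[\varepsilon^{1/4}-f(x)\big]_+^2\,dx\ge M_2\,\varepsilon^{3/4}[\log(1/\varepsilon)]^c$. **Assumption 2** (with parameter $\alpha>0$). $g_t(x)\ge\alpha f(x)$ for all $\varepsilon\in(0,\varepsilon_0]$,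 $x\in Q^\varepsilon$ and $t>0$. **Theorem.** For all $d$, $\alpha$, $M_1$ there is a threshold $M_2^{\min}(d,\alpha,M_1)>0$ such that the following holds whenever $M_2\ge M_2^{\min}(d,\alpha,M_1)$. If Assumptions 1 and 2 hold, then there is a constant $C>0$, not depending on $t$, such that at every time $t>0$ at which $s\mapsto\mathcal L(g_s)$ is differentiable and $\varepsilon_t:=|d\mathcal L(g_t)/dt|$ satisfies $0<\varepsilon_t\le\varepsilon_0$, one has $$\varepsilon_t\ \ge\ C\cdot\max_{i=1,\dots,K}\Big\{\Big[\int_{Q_i^{\varepsilon_t}}(g_t-f)^2\,d\lambda\Big]^2\cdot\min\big(|Q_i^{\varepsilon_t}|,|Q_i^{\varepsilon_t}|^{-1}\big)\Big\}.$$ -/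

import Mathlib

open Set MeasureTheory
open scoped ContDiff

/-- Euclidean space `ℝ^d`. -/
abbrev E (d : ℕ) : Type := EuclideanSpace ℝ (Fin d)

/-- Probability densities with respect to Lebesgue measure. -/
structure IsProbDensity {d : ℕ} (p : E d → ℝ) : Prop where
  nonneg : ∀ x, 0 ≤ p x
  integrable : Integrable p
  integral_eq_one : ∫ x, p x = 1

/-- `u` is the first variation of the functional `F` at `ρ`: the derivative of `F` at `ρ` in the
direction of a perturbation `ψ` is `∫ u ψ`. The perturbations are the smooth compactly supported
functions of total mass zero, so that `ρ + s ψ` keeps the mass of `ρ`; `u` is then determined up to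
an additive constant. -/
def IsFirstVariation {d : ℕ} (F : (E d → ℝ) → ℝ) (ρ u : E d → ℝ) : Prop :=
  LocallyIntegrable u ∧
    ∀ ψ : E d → ℝ, ContDiff ℝ ∞ ψ → HasCompactSupport ψ → ∫ x, ψ x = 0 →
      HasDerivAt (fun s : ℝ => F (fun x => ρ x + s * ψ x)) (∫ x, u x * ψ x) 0

/-- The continuity equation `∂ₜ g + ∇ · (v g) = 0` on `(0, ∞) × ℝ^d`, in the sense of
distributions. -/
def ContinuityEquation {d : ℕ} (g : ℝ → E d → ℝ) (v : ℝ → E d → E d) : Prop :=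
  ∀ φ : ℝ × E d → ℝ, ContDiff ℝ ∞ φ → HasCompactSupport φ → tsupport φ ⊆ Ioi 0 ×ˢ univ →
    ∫ t in Ioi (0 : ℝ), ∫ x,
      (deriv (fun s => φ (s, x)) t + inner ℝ (v t x) (gradient (fun y => φ (t, y)) x)) * g t x = 0

/-- The velocity `v t` lies in `L²(g t)` for almost every `t`, with locally integrable norm in time.
Together with narrow continuity and the continuity equation, this is the description of the
absolutely continuous curves of the quadratic Wasserstein space by their velocity. -/
def LocallyFiniteSpeed {d : ℕ} (g : ℝ → E d → ℝ) (v : ℝ → E d → E d) : Prop :=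
  ∀ a b : ℝ, 0 < a →
    ∫⁻ t in Icc a b, (∫⁻ x, ‖v t x‖ₑ ^ 2 * ENNReal.ofReal (g t x)) ^ (1 / 2 : ℝ) < ⊤

/-- `g` is (the family of densities of) a Wasserstein gradient flow of `F` on the time interval
`(0, ∞)`: an absolutely continuous curve of probability measures with finite second moment that
solves the continuity equation with velocity `v = - ∇ (δF/δν)(g t)`. -/
structure IsWassersteinGradientFlow {d : ℕ} (F : (E d → ℝ) → ℝ) (g : ℝ → E d → ℝ) : Prop where
  density : ∀ t, 0 < t → IsProbDensity (g t)
  second_moment : ∀ t, 0 < t → Integrable (fun x => ‖x‖ ^ 2 * g t x)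
  narrowly_continuous : ∀ φ : E d → ℝ, Continuous φ → (∃ B, ∀ x, |φ x| ≤ B) →
    ContinuousOn (fun t => ∫ x, φ x * g t x) (Ioi 0)
  velocity : ∃ u : ℝ → E d → ℝ,
    (∀ t, 0 < t → Differentiable ℝ (u t) ∧ IsFirstVariation F (g t) (u t)) ∧
    LocallyFiniteSpeed g (fun t x => -gradient (u t) x) ∧
    ContinuityEquation g (fun t x => -gradient (u t) x)

/-- The squared `L²` distance to the target density `f`. -/
noncomputable def sqL2Dist {d : ℕ} (f g : E d → ℝ) : ℝ := ∫ x, (g x - f x) ^ 2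

/-- Closed balls of positive radius. -/
def IsBall {d : ℕ} (B : Set (E d)) : Prop :=
  ∃ (x : E d) (r : ℝ), 0 < r ∧ B = Metric.closedBall x r

/-- For every `ε ∈ (0, ε₀]`, the `K` disjoint balls `Q ε i` cover the modes of `f`, with the tail
conditions of parameters `c`, `M₁`, `M₂`. -/
structure CoversModes {d K : ℕ} (f : E d → ℝ) (ε₀ c M₁ M₂ : ℝ) (Q : ℝ → Fin K → Set (E d)) :
    Prop where
  isBall : ∀ ε ∈ Ioc 0 ε₀, ∀ i, IsBall (Q ε i)
  disjoint : ∀ ε ∈ Ioc 0 ε₀, ∀ i j, i ≠ j → Disjoint (Q ε i) (Q ε j)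
  inf_le : ∀ ε ∈ Ioc 0 ε₀, ∀ i, sInf (f '' Q ε i) ≤ ε ^ (1 / 4 : ℝ)
  mass_ge : ∀ ε ∈ Ioc 0 ε₀, 1 - ε ^ (1 / 4 : ℝ) ≤ ∫ x in ⋃ i, Q ε i, f x
  sup_le : ∀ ε ∈ Ioc 0 ε₀, ∀ i, ∀ B : Set (E d), IsBall B → B ⊆ Q ε i →
    volume.real B ^ (2 / d : ℝ) * √((volume.real B)⁻¹ * ∫ x in B, (f x ^ 2)⁻¹)
      ≤ M₁ * ε ^ (-(1 / 4) : ℝ) * Real.log (1 / ε) ^ c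
  tail_ge : ∀ ε ∈ Ioc 0 ε₀, ∀ i,
    M₂ * ε ^ (3 / 4 : ℝ) * Real.log (1 / ε) ^ c
      ≤ ∫ x in Q ε i, (max (ε ^ (1 / 4 : ℝ) - f x) 0) ^ 2

open Filter Topology

/-! Write `w = g t - f` and `ε = |ℓ|`. The proof bounds the squared `L²` norm `X = ∫ w²` over the
whole space by a constant times `ε^(1/2)`; since `min (|Q|, |Q|⁻¹) ≤ 1`, this bounds every term of
the maximum.

Energy dissipation gives `∫ g |∇w|² ≤ ε` (`lintegral_dissipation_le`). The bound `α f ≤ g` extends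
from the balls to all of space, because the balls capture almost all the mass of `f`
(`mul_le_of_forall_mem`). Hence `|w|` is at most a multiple of `g`, and `∫ |w| |∇w|²` is of order
`ε`.

A Nash type inequality (`volume_real_mul_integral_sq_le`) then bounds `X` by this weighted gradient
integral and `N = ∫ |w|`. As `f` and `g t` have equal mass, `N` is controlled by the mass of `f`
outside the balls, at most `ε^(1/4)`, and by `√(|Q| X)` (`sq_integral_abs_sub_le`). By Jensen, the
mean of `f⁻²` over a ball is at least the square of its volume, so the bound on these means keeps
`|Q|` below a small power of `1/ε` (`exists_volume_le`). Choosing the scales closes the estimate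
(`exists_const_of_nash`).

The delicate point is the dissipation: `g` has no classical time derivative, and nothing is assumed
about decay at infinity. The energy is therefore localized by cutoffs, and the square is replaced by
a convex function of bounded slope. Convexity differentiates this energy in time; the finite speed
of the curve makes the cutoff error vanish. -/

/-! ### Weak derivatives, the first variation, and smooth approximation. -/

theorem exists_eqOn_const_of_integral_mul_eq_zero {V : Type*} [NormedAddCommGroup V]
    [NormedSpace ℝ V] [FiniteDimensional ℝ V] [MeasurableSpace V] [BorelSpace V]
    (μ : Measure V) [μ.IsAddHaarMeasure] {U : Set V} (hU : IsOpen U)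
    {w : V → ℝ} (hw : ContinuousOn w U)
    (h : ∀ ψ : V → ℝ, ContDiff ℝ ∞ ψ → HasCompactSupport ψ → tsupport ψ ⊆ U →
      ∫ x, ψ x ∂μ = 0 → ∫ x, ψ x * w x ∂μ = 0) :
    ∃ c, EqOn w (fun _ => c) U := by
  rcases U.eq_empty_or_nonempty with rfl | ⟨x₀, hx₀⟩
  · exact ⟨0, by simp⟩
  obtain ⟨r, hr, hrU⟩ := Metric.nhds_basis_closedBall.mem_iff.1 (hU.mem_nhds hx₀)
  let b : ContDiffBump x₀ := ⟨r / 2, r, by positivity, by linarith⟩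
  have hb1 : ContDiff ℝ ∞ (b.normed μ) := b.contDiff_normed
  have hb2 : HasCompactSupport (b.normed μ) := b.hasCompactSupport_normed
  have hb3 : tsupport (b.normed μ) ⊆ U := by rw [b.tsupport_normed_eq]; exact hrU
  have hb4 : ∫ x, b.normed μ x ∂μ = 1 := b.integral_normed
  have key : ∀ ψ : V → ℝ, ContDiff ℝ ∞ ψ → HasCompactSupport ψ → tsupport ψ ⊆ U →
      Integrable (fun x => ψ x * w x) μ := by
    intro ψ h1 h2 h3
    refine Continuous.integrable_of_hasCompactSupport ?_ h2.mul_right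
    refine ContinuousOn.continuous_of_tsupport_subset (h1.continuous.continuousOn.mul hw) hU ?_
    exact (tsupport_mul_subset_left).trans h3
  set c := ∫ x, b.normed μ x * w x ∂μ with hc
  refine ⟨c, ?_⟩
  have hae : ∀ᵐ x ∂μ, x ∈ U → w x - c = 0 := by
    refine hU.ae_eq_zero_of_integral_contDiff_smul_eq_zero
      ((hw.sub continuousOn_const).locallyIntegrableOn hU.measurableSet) ?_
    intro ψ h1 h2 h3
    have hi : Integrable ψ μ := h1.continuous.integrable_of_hasCompactSupport h2
    have hib : Integrable (b.normed μ) μ := hb1.continuous.integrable_of_hasCompactSupport hb2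
    -- Subtracting a multiple of one fixed normalized bump makes any test function mean-zero. `U`
    -- need not be connected, since `ψ` and the bump may live in different components.
    have := h (fun x => ψ x - (∫ y, ψ y ∂μ) * b.normed μ x) (h1.sub (contDiff_const.mul hb1))
      (h2.sub hb2.mul_left)
      ((tsupport_sub _ _).trans (union_subset h3 ((tsupport_mul_subset_right).trans hb3)))
      (by rw [integral_sub hi (hib.const_mul _), integral_const_mul, hb4]; ring)
    simp only [sub_mul, mul_assoc] at this
    rw [integral_sub (key ψ h1 h2 h3) ((key _ hb1 hb2 hb3).const_mul _), integral_const_mul] at this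
    simp only [smul_eq_mul, mul_sub]
    rw [integral_sub (key ψ h1 h2 h3) (hi.mul_const _), integral_mul_const]
    linarith
  have : w =ᵐ[μ.restrict U] fun _ => c := by
    rw [Filter.EventuallyEq, ae_restrict_iff' hU.measurableSet]
    filter_upwards [hae] with x hx hxU
    linarith [hx hxU]
  exact Measure.eqOn_open_of_ae_eq this hU hw continuousOn_const

/-- Testing with primitives of mean-zero functions and integrating by parts shows that `A` minus a
primitive of `B` is orthogonal to every mean-zero test function, hence constant. -/
theorem sub_eq_integral_of_weak_deriv {A B : ℝ → ℝ} (hA : ContinuousOn A (Ioi 0))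
    (hB : ContinuousOn B (Ioi 0))
    (h : ∀ η : ℝ → ℝ, ContDiff ℝ ∞ η → HasCompactSupport η → tsupport η ⊆ Ioi 0 →
      ∫ t in Ioi (0 : ℝ), (deriv η t * A t + η t * B t) = 0)
    {s t : ℝ} (hs : 0 < s) (ht : 0 < t) : A t - A s = ∫ τ in s..t, B τ := by
  have hBi : ∀ {a b : ℝ}, 0 < a → 0 < b → IntervalIntegrable B volume a b := fun ha hb =>
    (hB.mono (fun x hx => lt_of_lt_of_le (lt_min ha hb) hx.1)).intervalIntegrable
  set P : ℝ → ℝ := fun t => ∫ τ in (1 : ℝ)..t, B τ with hP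
  have hPd : ∀ x, 0 < x → HasDerivAt P (B x) x := by
    intro x hx
    refine intervalIntegral.integral_hasDerivAt_right (hBi one_pos hx) ?_
      (hB.continuousAt (Ioi_mem_nhds hx))
    exact hB.stronglyMeasurableAtFilter isOpen_Ioi x hx
  have hPc : ContinuousOn P (Ioi 0) := fun x hx => (hPd x hx).continuousAt.continuousWithinAt
  obtain ⟨c, hc⟩ := exists_eqOn_const_of_integral_mul_eq_zero (volume : Measure ℝ) isOpen_Ioi
    (hA.sub hPc) (by
      intro ψ h1 h2 h3 h0
      obtain ⟨a, b, ha, hab, hsub⟩ : ∃ a b : ℝ, 0 < a ∧ a ≤ b ∧ tsupport ψ ⊆ Icc a b := by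
        rcases (tsupport ψ).eq_empty_or_nonempty with he | hne
        · exact ⟨1, 1, one_pos, le_rfl, by simp [he]⟩
        · have hcpt : IsCompact (tsupport ψ) := h2
          refine ⟨sInf (tsupport ψ), sSup (tsupport ψ), h3 (hcpt.sInf_mem hne), ?_,
            fun x hx => ⟨csInf_le hcpt.bddBelow hx, le_csSup hcpt.bddAbove hx⟩⟩
          exact csInf_le hcpt.bddBelow (hcpt.sSup_mem hne)
      have hz : ∀ x, x ∉ Icc a b → ψ x = 0 := fun x hx =>
        image_eq_zero_of_notMem_tsupport fun hx' => hx (hsub hx')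
      have hint : ∀ k : ℝ → ℝ, (∀ x, x ∉ Icc a b → k x = 0) → ∫ x, k x = ∫ x in a..b, k x := by
        intro k hk
        rw [intervalIntegral.integral_of_le hab, ← integral_Icc_eq_integral_Ioc]
        exact (setIntegral_eq_integral_of_forall_compl_eq_zero hk).symm
      -- This primitive vanishes to the right of `b` precisely because `ψ` has mean zero.
      set η : ℝ → ℝ := fun x => ∫ y in a..x, ψ y with hη
      have hηd : ∀ x, HasDerivAt η (ψ x) x := fun x =>
        h1.continuous.integral_hasStrictDerivAt a x |>.hasDerivAt
      have hηd' : deriv η = ψ := funext fun x => (hηd x).deriv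
      have hηs : ContDiff ℝ ∞ η := by
        rw [contDiff_infty_iff_deriv, hηd']
        exact ⟨fun x => (hηd x).differentiableAt, h1⟩
      have hηb : η b = 0 := by rw [hη]; simp only; rw [← hint ψ hz, h0]
      have hηz : ∀ x, x ∉ Icc a b → η x = 0 := by
        intro x hx
        rcases lt_or_ge x a with hxa | hxa
        · simp only [hη]
          rw [intervalIntegral.integral_symm, intervalIntegral.integral_of_le hxa.le,
            ← integral_Ico_eq_integral_Ioc, setIntegral_eq_zero_of_forall_eq_zero, neg_zero]
          exact fun y hy => hz y fun hy' => absurd hy.2 (not_lt.2 hy'.1)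
        · have hxb : b < x := by
            by_contra hcon
            exact hx ⟨hxa, not_lt.1 hcon⟩
          have : η x = η b + ∫ y in b..x, ψ y :=
            (intervalIntegral.integral_add_adjacent_intervals
              (h1.continuous.intervalIntegrable _ _) (h1.continuous.intervalIntegrable _ _)).symm
          rw [this, hηb, intervalIntegral.integral_of_le hxb.le,
            setIntegral_eq_zero_of_forall_eq_zero, zero_add]
          exact fun y hy => hz y fun hy' => absurd hy.1 (not_lt.2 hy'.2)
      have hηt : tsupport η ⊆ Icc a b :=
        closure_minimal (fun x hx => by_contra fun hx' => hx (hηz x hx')) isClosed_Icc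
      have hpos : Icc a b ⊆ Ioi (0 : ℝ) := fun x hx => lt_of_lt_of_le ha hx.1
      have hw := h η hηs (isCompact_Icc.of_isClosed_subset (isClosed_tsupport _) hηt)
        (hηt.trans hpos)
      rw [setIntegral_eq_integral_of_forall_compl_eq_zero, hint, hηd'] at hw
      rotate_left
      · intro x hx; simp [hηd', hz x hx, hηz x hx]
      · intro x hx
        have : x ∉ Icc a b := fun hx' => hx (hpos hx')
        simp [hηd', hz x this, hηz x this]
      have hb : 0 < b := ha.trans_le hab
      have huI : uIcc a b ⊆ Ioi 0 := by rw [uIcc_of_le hab]; exact hpos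
      have i1 : IntervalIntegrable (fun x => ψ x * A x) volume a b :=
        (h1.continuous.continuousOn.mul (hA.mono huI)).intervalIntegrable
      have i2 : IntervalIntegrable (fun x => η x * B x) volume a b :=
        (hηs.continuous.continuousOn.mul (hB.mono huI)).intervalIntegrable
      have i3 : IntervalIntegrable (fun x => ψ x * P x) volume a b :=
        (h1.continuous.continuousOn.mul (hPc.mono huI)).intervalIntegrable
      have hibp := intervalIntegral.integral_mul_deriv_eq_deriv_mul (a := a) (b := b)
        (u := η) (v := P) (u' := ψ) (v' := B) (fun x _ => hηd x)
        (fun x hx => hPd x (huI hx)) (h1.continuous.intervalIntegrable _ _) (hBi ha hb)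
      rw [intervalIntegral.integral_add i1 i2, hibp, hηb] at hw
      rw [hint _ (fun x hx => by simp [hz x hx])]
      simp only [Pi.sub_apply, mul_sub]
      rw [intervalIntegral.integral_sub i1 i3]
      have : η a = 0 := by simp [hη]
      rw [this] at hw
      linarith)
  have h1 := hc hs
  have h2 := hc ht
  simp only [Pi.sub_apply] at h1 h2
  have : P t - P s = ∫ τ in s..t, B τ :=
    intervalIntegral.integral_interval_sub_left (hBi one_pos ht) (hBi one_pos hs)
  linarith

/-- The first variation of the squared `L²` distance is `2 (ρ - f)`, up to a constant. -/
theorem exists_firstVariation_sqL2Dist_eq {d : ℕ} {f ρ u : E d → ℝ} (hf : MemLp f 2)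
    (hρ : MemLp ρ 2) (hfc : Continuous f) (hρc : Continuous ρ) (huc : Continuous u)
    (hu : IsFirstVariation (sqL2Dist f) ρ u) : ∃ c, ∀ x, u x = 2 * (ρ x - f x) + c := by
  obtain ⟨c, hc⟩ := exists_eqOn_const_of_integral_mul_eq_zero (volume : Measure (E d)) isOpen_univ
    (w := fun x => u x - 2 * (ρ x - f x)) (by fun_prop) (by
      intro ψ h1 h2 _ h0
      have hd := hu.2 ψ h1 h2 h0
      have hψ : MemLp ψ 2 := h1.continuous.memLp_of_hasCompactSupport h2
      have hm : MemLp (fun x => ρ x - f x) 2 := hρ.sub hf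
      -- The functional is a quadratic polynomial in `s`; its linear coefficient is the derivative
      -- at `0`.
      have e : (fun s : ℝ => sqL2Dist f (fun x => ρ x + s * ψ x)) = fun s : ℝ =>
          (∫ x, (ρ x - f x) ^ 2) + s * (2 * ∫ x, (ρ x - f x) * ψ x) + s ^ 2 * ∫ x, ψ x ^ 2 := by
        funext s
        have i1 : Integrable (fun x => (ρ x - f x) ^ 2) := hm.integrable_sq
        have i2 : Integrable (fun x => (ρ x - f x) * ψ x) := hm.integrable_mul hψ
        have i3 : Integrable (fun x => ψ x ^ 2) := hψ.integrable_sq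
        rw [← integral_const_mul, ← integral_const_mul, ← integral_const_mul, ← integral_add i1,
          ← integral_add]
        · unfold sqL2Dist
          congr 1
          funext x
          ring
        · exact i1.add ((i2.const_mul _).const_mul _)
        · exact i3.const_mul _
        · exact (i2.const_mul _).const_mul _
      have hd' : HasDerivAt (fun s : ℝ => sqL2Dist f (fun x => ρ x + s * ψ x))
          (2 * ∫ x, (ρ x - f x) * ψ x) 0 := by
        rw [e]
        have := (((hasDerivAt_id (0 : ℝ)).mul_const (2 * ∫ x, (ρ x - f x) * ψ x)).const_add
          (∫ x, (ρ x - f x) ^ 2)).add (((hasDerivAt_id (0 : ℝ)).pow 2).mul_const (∫ x, ψ x ^ 2))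
        convert! this using 1
        simp
      have heq := hd.unique hd'
      have i1 : Integrable (fun x => u x * ψ x) :=
        (huc.mul h1.continuous).integrable_of_hasCompactSupport h2.mul_left
      have i2 : Integrable (fun x => (ρ x - f x) * ψ x) := hm.integrable_mul hψ
      calc ∫ x, ψ x * (u x - 2 * (ρ x - f x))
          = ∫ x, (u x * ψ x - 2 * ((ρ x - f x) * ψ x)) := by congr 1; funext x; ring
        _ = 0 := by rw [integral_sub i1 (i2.const_mul _), integral_const_mul, heq, sub_self])
  exact ⟨c, fun x => by have := hc (mem_univ x); simp only at this; linarith⟩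

/-- A compactly supported `C¹` function is the limit in `C¹` of smooth functions supported in a
fixed compact set. -/
theorem exists_smooth_approx_C1 {d : ℕ} {ψ : E d → ℝ} (hψ : ContDiff ℝ 1 ψ)
    (hc : HasCompactSupport ψ) :
    ∃ χ : E d → ℝ, Continuous χ ∧ HasCompactSupport χ ∧ ∀ ε > 0, ∃ ψ' : E d → ℝ,
      ContDiff ℝ ∞ ψ' ∧ HasCompactSupport ψ' ∧ (∀ x, |ψ' x - ψ x| ≤ ε) ∧
        ∀ x, ‖fderiv ℝ ψ' x - fderiv ℝ ψ x‖ ≤ ε * χ x := by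
  obtain ⟨R, hR0, hR⟩ : ∃ R : ℝ, 0 < R ∧ tsupport ψ ⊆ Metric.closedBall 0 R := by
    obtain ⟨R, hR⟩ := hc.isCompact.isBounded.subset_closedBall 0
    exact ⟨max R 1, by positivity, hR.trans (Metric.closedBall_subset_closedBall (le_max_left _ _))⟩
  -- Mollification at radius at most `1` keeps all supports in the ball where `χ = 1`. Weighting the
  -- derivative error by this fixed `χ` makes it integrable against a flux that is only locally
  -- bounded.
  let χ : ContDiffBump (0 : E d) := ⟨R + 1, R + 2, by positivity, by linarith⟩
  refine ⟨χ, χ.continuous, χ.hasCompactSupport, fun ε hε => ?_⟩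
  have u1 : UniformContinuous ψ := hc.uniformContinuous_of_continuous hψ.continuous
  have hψ' : Continuous (fderiv ℝ ψ) := hψ.continuous_fderiv one_ne_zero
  have u2 : UniformContinuous (fderiv ℝ ψ) := (hc.fderiv ℝ).uniformContinuous_of_continuous hψ'
  obtain ⟨δ₁, hδ₁, h1⟩ := Metric.uniformContinuous_iff.1 u1 ε hε
  obtain ⟨δ₂, hδ₂, h2⟩ := Metric.uniformContinuous_iff.1 u2 ε hε
  set δ := min 1 (min δ₁ δ₂) with hδ
  have hδ0 : 0 < δ := by positivity
  let b : ContDiffBump (0 : E d) := ⟨δ / 2, δ, by positivity, by linarith⟩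
  have hbi : LocallyIntegrable (b.normed volume) := (b.continuous_normed).locallyIntegrable
  set ψ' : E d → ℝ := convolution (b.normed volume) ψ (ContinuousLinearMap.lsmul ℝ ℝ) volume
    with hψ'd
  have hfd : ∀ x, fderiv ℝ ψ' x =
      convolution (b.normed volume) (fderiv ℝ ψ) (ContinuousLinearMap.lsmul ℝ ℝ) volume x := by
    intro x
    rw [(hc.hasFDerivAt_convolution_right (ContinuousLinearMap.lsmul ℝ ℝ) hbi hψ x).fderiv]
    simp only [convolution_def]
    congr 1
  have hcs : HasCompactSupport ψ' := b.hasCompactSupport_normed.convolution _ hc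
  have hsupp : tsupport ψ' ⊆ Metric.closedBall 0 (R + 1) := by
    refine closure_minimal ?_ Metric.isClosed_closedBall
    refine (support_convolution_subset _).trans ?_
    rintro _ ⟨y, hy, z, hz, rfl⟩
    have hy' : ‖y‖ < δ := by
      rw [b.support_normed_eq] at hy
      simpa using hy
    have hz' : ‖z‖ ≤ R := by simpa using hR (subset_tsupport _ hz)
    have : δ ≤ 1 := min_le_left _ _
    simpa using (norm_add_le y z).trans (by linarith)
  refine ⟨ψ', b.hasCompactSupport_normed.contDiff_convolution_left _ b.contDiff_normed
    hψ.continuous.locallyIntegrable, hcs, fun x => ?_, fun x => ?_⟩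
  · rw [← Real.dist_eq]
    refine ContDiffBump.dist_normed_convolution_le hψ.continuous.aestronglyMeasurable
      fun y hy => (h1 (lt_of_lt_of_le hy ?_)).le
    exact (min_le_right _ _).trans (min_le_left _ _)
  · by_cases hx : x ∈ Metric.closedBall (0 : E d) (R + 1)
    · rw [χ.one_of_mem_closedBall hx, mul_one, hfd, ← dist_eq_norm]
      refine ContDiffBump.dist_normed_convolution_le hψ'.aestronglyMeasurable
        fun y hy => (h2 (lt_of_lt_of_le hy ?_)).le
      exact (min_le_right _ _).trans (min_le_right _ _)
    · have e1 : fderiv ℝ ψ' x = 0 :=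
        image_eq_zero_of_notMem_tsupport fun h => hx (hsupp (tsupport_fderiv_subset ℝ h))
      have e2 : fderiv ℝ ψ x = 0 :=
        image_eq_zero_of_notMem_tsupport fun h => hx
          (Metric.closedBall_subset_closedBall (by linarith) (hR (tsupport_fderiv_subset ℝ h)))
      rw [e1, e2, sub_self, norm_zero]
      exact mul_nonneg hε.le χ.nonneg

/-! ### The weak equation of the flow, tested with `C¹` functions. -/

/-- A Wasserstein gradient flow of `sqL2Dist f` in regular form: `G t` is the gradient of
`g t - f`, and the velocity is `-2 G t`. -/
structure IsRegularFlow {d : ℕ} (f : E d → ℝ) (g : ℝ → E d → ℝ) (G : ℝ → E d → E d) : Prop where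
  target : IsProbDensity f
  target_continuous : Continuous f
  target_memLp : MemLp f 2
  density : ∀ t, 0 < t → IsProbDensity (g t)
  memLp : ∀ t, 0 < t → MemLp (g t) 2
  continuousOn : ContinuousOn (fun p : ℝ × E d => g p.1 p.2) (Ioi 0 ×ˢ univ)
  continuousOn_gradient : ContinuousOn (fun p : ℝ × E d => G p.1 p.2) (Ioi 0 ×ˢ univ)
  hasGradientAt : ∀ t, 0 < t → ∀ x, HasGradientAt (fun y => g t y - f y) (G t x) x
  speed : LocallyFiniteSpeed g fun t x => -(2 : ℝ) • G t x
  continuity : ContinuityEquation g fun t x => -(2 : ℝ) • G t x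

/-- The integral of the flux `g ∇(g - f)` against the differential of `ψ`. -/
noncomputable def fluxIntegral {d : ℕ} (g : ℝ → E d → ℝ) (G : ℝ → E d → E d) (ψ : E d → ℝ)
    (t : ℝ) : ℝ :=
  ∫ x, fderiv ℝ ψ x (G t x) * g t x

namespace IsRegularFlow

variable {d : ℕ} {f : E d → ℝ} {g : ℝ → E d → ℝ} {G : ℝ → E d → E d}

theorem continuous_density (h : IsRegularFlow f g G) {t : ℝ} (ht : 0 < t) : Continuous (g t) := by
  have : ContinuousOn (fun x : E d => (t, x)) univ := by fun_prop
  exact continuousOn_univ.1 (h.continuousOn.comp this fun x _ => ⟨ht, mem_univ _⟩)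

theorem continuous_gradient (h : IsRegularFlow f g G) {t : ℝ} (ht : 0 < t) : Continuous (G t) := by
  have : ContinuousOn (fun x : E d => (t, x)) univ := by fun_prop
  exact continuousOn_univ.1 (h.continuousOn_gradient.comp this fun x _ => ⟨ht, mem_univ _⟩)

theorem integrable_mul_of_hasCompactSupport (h : IsRegularFlow f g G) {t : ℝ} (ht : 0 < t)
    {ψ : E d → ℝ} (hψ : Continuous ψ) (hc : HasCompactSupport ψ) :
    Integrable fun x => ψ x * g t x :=
  (hψ.mul (h.continuous_density ht)).integrable_of_hasCompactSupport hc.mul_right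

theorem integrable_flux (h : IsRegularFlow f g G) {t : ℝ} (ht : 0 < t)
    {ψ : E d → ℝ} (hψ : ContDiff ℝ 1 ψ) (hc : HasCompactSupport ψ) :
    Integrable fun x => fderiv ℝ ψ x (G t x) * g t x := by
  refine Continuous.integrable_of_hasCompactSupport ?_ ?_
  · exact ((hψ.continuous_fderiv one_ne_zero).clm_apply (h.continuous_gradient ht)).mul
      (h.continuous_density ht)
  · refine (hc.fderiv ℝ).mono' fun x hx => subset_tsupport _ fun h0 => hx ?_
    simp [h0]

theorem continuousOn_integral_mul (h : IsRegularFlow f g G)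
    {ψ : E d → ℝ} (hψ : Continuous ψ) (hc : HasCompactSupport ψ) :
    ContinuousOn (fun t => ∫ x, ψ x * g t x) (Ioi 0) := by
  refine continuousOn_integral_of_compact_support hc.isCompact ?_ ?_
  · exact (hψ.comp continuous_snd).continuousOn.mul h.continuousOn
  · intro t x _ hx
    rw [image_eq_zero_of_notMem_tsupport hx, zero_mul]

theorem continuousOn_fluxIntegral (h : IsRegularFlow f g G)
    {ψ : E d → ℝ} (hψ : ContDiff ℝ 1 ψ) (hc : HasCompactSupport ψ) :
    ContinuousOn (fluxIntegral g G ψ) (Ioi 0) := by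
  refine continuousOn_integral_of_compact_support (hc.fderiv ℝ).isCompact ?_ ?_
  · have h1 : ContinuousOn (fun p : ℝ × E d => fderiv ℝ ψ p.2) (Ioi 0 ×ˢ univ) :=
      ((hψ.continuous_fderiv one_ne_zero).comp continuous_snd).continuousOn
    exact (h1.clm_apply h.continuousOn_gradient).mul h.continuousOn
  · intro t x _ hx
    rw [image_eq_zero_of_notMem_tsupport hx]
    simp

theorem integral_mul_sub_of_smooth (h : IsRegularFlow f g G)
    {ψ : E d → ℝ} (hψ : ContDiff ℝ ∞ ψ) (hc : HasCompactSupport ψ) {s t : ℝ} (hs : 0 < s)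
    (ht : 0 < t) :
    (∫ x, ψ x * g t x) - ∫ x, ψ x * g s x = ∫ τ in s..t, -2 * fluxIntegral g G ψ τ := by
  have hψ1 : ContDiff ℝ 1 ψ := hψ.of_le (by norm_cast)
  refine sub_eq_integral_of_weak_deriv (A := fun t => ∫ x, ψ x * g t x)
    (B := fun t => -2 * fluxIntegral g G ψ t)
    (h.continuousOn_integral_mul hψ.continuous hc)
    (continuousOn_const.mul (h.continuousOn_fluxIntegral hψ1 hc)) ?_ hs ht
  intro η h1 h2 h3
  have hsub : tsupport (fun p : ℝ × E d => η p.1 * ψ p.2) ⊆ tsupport η ×ˢ tsupport ψ := by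
    refine closure_minimal (fun p hp => ?_) ((isClosed_tsupport _).prod (isClosed_tsupport _))
    exact ⟨subset_tsupport _ fun h0 => hp (by simp [h0]), subset_tsupport _ fun h0 => hp (by simp [h0])⟩
  have key := h.continuity (fun p => η p.1 * ψ p.2)
    ((h1.comp contDiff_fst).mul (hψ.comp contDiff_snd))
    ((h2.isCompact.prod hc.isCompact).of_isClosed_subset (isClosed_tsupport _) hsub)
    (hsub.trans (prod_mono h3 (subset_univ _)))
  refine Eq.trans ?_ key
  refine setIntegral_congr_fun measurableSet_Ioi fun t ht => ?_
  simp only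
  have e : ∀ x, (deriv (fun s => η s * ψ x) t +
      inner ℝ (-(2 : ℝ) • G t x) (gradient (fun y => η t * ψ y) x)) * g t x =
      deriv η t * (ψ x * g t x) + -2 * η t * (fderiv ℝ ψ x (G t x) * g t x) := by
    intro x
    have d1 : deriv (fun s => η s * ψ x) t = deriv η t * ψ x := by
      rw [deriv_mul_const]
      exact (h1.differentiable (by simp)).differentiableAt
    have d2 : fderiv ℝ (fun y => η t * ψ y) x = η t • fderiv ℝ ψ x :=
      fderiv_const_mul (hψ.differentiable (by simp)).differentiableAt _
    rw [d1, real_inner_comm, inner_gradient_left, d2]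
    simp
    ring
  simp_rw [e]
  rw [integral_add ((h.integrable_mul_of_hasCompactSupport ht hψ.continuous hc).const_mul _)
    ((h.integrable_flux ht hψ1 hc).const_mul _), integral_const_mul, integral_const_mul]
  unfold fluxIntegral
  ring

/-- The weak form of the equation between two times, for compactly supported `C¹` functions. -/
theorem integral_mul_sub (h : IsRegularFlow f g G)
    {ψ : E d → ℝ} (hψ : ContDiff ℝ 1 ψ) (hc : HasCompactSupport ψ) {s t : ℝ} (hs : 0 < s)
    (ht : 0 < t) :
    (∫ x, ψ x * g t x) - ∫ x, ψ x * g s x = ∫ τ in s..t, -2 * fluxIntegral g G ψ τ := by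
  obtain ⟨χ, hχ, hχc, happ⟩ := exists_smooth_approx_C1 hψ hc
  have hpos : uIcc s t ⊆ Ioi 0 := fun x hx => lt_of_lt_of_le (lt_min hs ht) hx.1
  set m : ℝ → ℝ := fun τ => ∫ x, χ x * (‖G τ x‖ * g τ x) with hm
  have hmc : ContinuousOn m (Ioi 0) := by
    refine continuousOn_integral_of_compact_support hχc.isCompact ?_ ?_
    · exact (hχ.comp continuous_snd).continuousOn.mul
        (h.continuousOn_gradient.norm.mul h.continuousOn)
    · intro t x _ hx
      rw [image_eq_zero_of_notMem_tsupport hx, zero_mul]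
  -- Each endpoint contributes an error of at most `ε`, because `g` has mass one; the integral
  -- accounts for the flux.
  set C := 2 + |∫ τ in s..t, 2 * m τ| with hC
  have hC0 : 0 < C := by positivity
  have bound : ∀ ε > 0, |((∫ x, ψ x * g t x) - ∫ x, ψ x * g s x) -
      ∫ τ in s..t, -2 * fluxIntegral g G ψ τ| ≤ ε * C := by
    intro ε hε
    obtain ⟨ψ', k1, k2, k3, k4⟩ := happ ε hε
    have k1' : ContDiff ℝ 1 ψ' := k1.of_le (by norm_cast)
    have e := h.integral_mul_sub_of_smooth k1 k2 hs ht
    have b1 : ∀ τ, 0 < τ → |(∫ x, ψ' x * g τ x) - ∫ x, ψ x * g τ x| ≤ ε := by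
      intro τ hτ
      rw [← integral_sub (h.integrable_mul_of_hasCompactSupport hτ k1.continuous k2)
        (h.integrable_mul_of_hasCompactSupport hτ hψ.continuous hc)]
      calc |∫ x, (ψ' x * g τ x - ψ x * g τ x)| ≤ ∫ x, ε * g τ x := by
            rw [← Real.norm_eq_abs]
            refine norm_integral_le_of_norm_le ((h.density τ hτ).integrable.const_mul ε)
              (ae_of_all _ fun x => ?_)
            rw [← sub_mul, Real.norm_eq_abs, abs_mul, abs_of_nonneg ((h.density τ hτ).nonneg x)]
            exact mul_le_mul_of_nonneg_right (k3 x) ((h.density τ hτ).nonneg x)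
        _ = ε := by rw [integral_const_mul, (h.density τ hτ).integral_eq_one, mul_one]
    have b2 : ∀ τ, 0 < τ → |fluxIntegral g G ψ' τ - fluxIntegral g G ψ τ| ≤ ε * m τ := by
      intro τ hτ
      unfold fluxIntegral
      rw [← integral_sub (h.integrable_flux hτ k1' k2) (h.integrable_flux hτ hψ hc), hm]
      simp only
      rw [← integral_const_mul, ← Real.norm_eq_abs]
      refine norm_integral_le_of_norm_le ?_ (ae_of_all _ fun x => ?_)
      · refine Integrable.const_mul (Continuous.integrable_of_hasCompactSupport ?_ hχc.mul_right) _
        exact hχ.mul ((h.continuous_gradient hτ).norm.mul (h.continuous_density hτ))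
      · rw [← sub_mul, ← sub_apply, norm_mul, Real.norm_of_nonneg ((h.density τ hτ).nonneg x),
          ← mul_assoc, ← mul_assoc]
        refine mul_le_mul_of_nonneg_right ?_ ((h.density τ hτ).nonneg x)
        exact (ContinuousLinearMap.le_opNorm _ _).trans
          (mul_le_mul_of_nonneg_right (k4 x) (norm_nonneg _))
    have i1 : IntervalIntegrable (fun τ => -2 * fluxIntegral g G ψ' τ) volume s t :=
      (continuousOn_const.mul
        ((h.continuousOn_fluxIntegral k1' k2).mono hpos)).intervalIntegrable
    have i2 : IntervalIntegrable (fun τ => -2 * fluxIntegral g G ψ τ) volume s t :=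
      (continuousOn_const.mul
        ((h.continuousOn_fluxIntegral hψ hc).mono hpos)).intervalIntegrable
    have b3 : |(∫ τ in s..t, -2 * fluxIntegral g G ψ' τ) -
        ∫ τ in s..t, -2 * fluxIntegral g G ψ τ| ≤ ε * |∫ τ in s..t, 2 * m τ| := by
      rw [← intervalIntegral.integral_sub i1 i2]
      have : ε * |∫ τ in s..t, 2 * m τ| = |∫ τ in s..t, ε * (2 * m τ)| := by
        rw [intervalIntegral.integral_const_mul ε fun τ => 2 * m τ, abs_mul, abs_of_pos hε]
      rw [this, ← Real.norm_eq_abs]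
      refine intervalIntegral.norm_integral_le_abs_of_norm_le ?_ ?_
      · refine ae_restrict_of_forall_mem measurableSet_uIoc fun τ hτ => ?_
        have := b2 τ (hpos (uIoc_subset_uIcc hτ))
        rw [Real.norm_eq_abs, ← mul_sub, abs_mul]
        norm_num
        linarith
      · exact (continuousOn_const.mul (continuousOn_const.mul (hmc.mono hpos))).intervalIntegrable
    have c1 := b1 t ht
    have c2 := b1 s hs
    rw [← e] at b3
    rw [abs_le] at *
    constructor <;> nlinarith
  have hz : |((∫ x, ψ x * g t x) - ∫ x, ψ x * g s x) -
      ∫ τ in s..t, -2 * fluxIntegral g G ψ τ| ≤ 0 := by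
    refine le_of_forall_pos_le_add fun ε hε => ?_
    have := bound (ε / C) (by positivity)
    rw [div_mul_cancel₀ _ hC0.ne'] at this
    linarith
  have := abs_nonpos_iff.1 hz
  linarith

end IsRegularFlow

/-! ### The regularized square. -/

/-- A convex regularization of `y ^ 2` with bounded slope. -/
noncomputable def softSq (δ y : ℝ) : ℝ := 2 * y ^ 2 / (√(1 + δ * y ^ 2) + 1)

/-- The derivative of `softSq δ`. -/
noncomputable def softSqDeriv (δ y : ℝ) : ℝ := 2 * y / √(1 + δ * y ^ 2)

/-- The second derivative of `softSq δ`. -/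
noncomputable def softSqDeriv₂ (δ y : ℝ) : ℝ := 2 / ((1 + δ * y ^ 2) * √(1 + δ * y ^ 2))

section softSq

variable {δ : ℝ}

theorem one_add_mul_sq_pos (hδ : 0 < δ) (y : ℝ) : 0 < 1 + δ * y ^ 2 := by positivity

theorem softSq_nonneg (δ y : ℝ) : 0 ≤ softSq δ y := by unfold softSq; positivity

theorem softSq_le_sq (hδ : 0 < δ) (y : ℝ) : softSq δ y ≤ y ^ 2 := by
  unfold softSq
  rw [div_le_iff₀ (by positivity)]
  have : 1 ≤ √(1 + δ * y ^ 2) := Real.one_le_sqrt.2 (by nlinarith [sq_nonneg y])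
  nlinarith [sq_nonneg y]

theorem continuous_softSq (hδ : 0 < δ) : Continuous (softSq δ) := by
  unfold softSq
  refine Continuous.div (by fun_prop) (by fun_prop) fun y => by positivity

/-- Convexity, read off from `softSq δ y = (2/δ) (√(1 + δ y²) - 1)`: the gap to the tangent line is
a positive multiple of `p q - (1 + δ a b)`, nonnegative by Cauchy-Schwarz for `(1, √δ a)` and `(1,
√δ b)`. -/
theorem softSq_add_le (hδ : 0 < δ) (a b : ℝ) :
    softSq δ a + softSqDeriv δ a * (b - a) ≤ softSq δ b := by
  have form : ∀ y, softSq δ y = 2 / δ * (√(1 + δ * y ^ 2) - 1) := by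
    intro y
    have h := Real.sq_sqrt (one_add_mul_sq_pos hδ y).le
    unfold softSq
    rw [div_eq_iff (by positivity)]
    set p := √(1 + δ * y ^ 2)
    field_simp
    linear_combination (-1) * h
  rw [form, form, softSqDeriv]
  set p := √(1 + δ * a ^ 2) with hp
  set q := √(1 + δ * b ^ 2) with hq
  have hp0 : 0 < p := Real.sqrt_pos.2 (one_add_mul_sq_pos hδ a)
  have hq0 : 0 < q := Real.sqrt_pos.2 (one_add_mul_sq_pos hδ b)
  have hp2 : p ^ 2 = 1 + δ * a ^ 2 := Real.sq_sqrt (one_add_mul_sq_pos hδ a).le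
  have hq2 : q ^ 2 = 1 + δ * b ^ 2 := Real.sq_sqrt (one_add_mul_sq_pos hδ b).le
  have key : 1 + δ * (a * b) ≤ p * q := by
    refine le_of_sq_le_sq ?_ (by positivity)
    rw [mul_pow, hp2, hq2]
    nlinarith [mul_nonneg hδ.le (sq_nonneg (a - b))]
  have e : 2 / δ * (q - 1) - (2 / δ * (p - 1) + 2 * a / p * (b - a)) =
      2 / (δ * p) * (p * q - (1 + δ * (a * b))) := by
    field_simp
    linear_combination (-1) * hp2
  have : 0 ≤ 2 / (δ * p) * (p * q - (1 + δ * (a * b))) :=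
    mul_nonneg (by positivity) (by linarith)
  linarith

theorem abs_softSqDeriv_le (hδ : 0 < δ) (y : ℝ) : |softSqDeriv δ y| ≤ 2 / √δ := by
  unfold softSqDeriv
  rw [abs_div, abs_of_pos (Real.sqrt_pos.2 (one_add_mul_sq_pos hδ y)),
    div_le_div_iff₀ (Real.sqrt_pos.2 (one_add_mul_sq_pos hδ y)) (Real.sqrt_pos.2 hδ), abs_mul,
    abs_two, mul_assoc]
  refine mul_le_mul_of_nonneg_left ?_ zero_le_two
  rw [← Real.sqrt_sq_eq_abs, ← Real.sqrt_mul (sq_nonneg y)]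
  exact Real.sqrt_le_sqrt (by linarith)

theorem continuous_softSqDeriv (hδ : 0 < δ) : Continuous (softSqDeriv δ) := by
  unfold softSqDeriv
  exact Continuous.div (by fun_prop) (by fun_prop)
    fun y => (Real.sqrt_pos.2 (one_add_mul_sq_pos hδ y)).ne'

theorem continuous_softSqDeriv₂ (hδ : 0 < δ) : Continuous (softSqDeriv₂ δ) := by
  unfold softSqDeriv₂
  refine Continuous.div (by fun_prop) (by fun_prop) fun y => ?_
  have := Real.sqrt_pos.2 (one_add_mul_sq_pos hδ y)
  positivity

theorem hasDerivAt_softSqDeriv (hδ : 0 < δ) (y : ℝ) :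
    HasDerivAt (softSqDeriv δ) (softSqDeriv₂ δ y) y := by
  have h0 := one_add_mul_sq_pos hδ y
  have h1 := Real.sqrt_pos.2 h0
  have hs := Real.sq_sqrt h0.le
  have d1 : HasDerivAt (fun y : ℝ => 1 + δ * y ^ 2) (δ * (2 * y)) y := by
    simpa using (((hasDerivAt_id y).pow 2).const_mul δ).const_add 1
  have d2 := d1.sqrt h0.ne'
  have d3 : HasDerivAt (fun y : ℝ => 2 * y) 2 y := by
    simpa using (hasDerivAt_id y).const_mul (2 : ℝ)
  have d4 := d3.div d2 h1.ne'
  have e : softSqDeriv₂ δ y = (2 * √(1 + δ * y ^ 2) -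
      2 * y * (δ * (2 * y) / (2 * √(1 + δ * y ^ 2)))) / √(1 + δ * y ^ 2) ^ 2 := by
    unfold softSqDeriv₂
    set p := √(1 + δ * y ^ 2)
    rw [← hs]
    field_simp
    linear_combination (-1) * hs
  rw [e]
  exact d4

theorem softSqDeriv₂_nonneg (hδ : 0 < δ) (y : ℝ) : 0 ≤ softSqDeriv₂ δ y := by
  unfold softSqDeriv₂; positivity

/-- The defect from the second derivative `2` of the square is linear in `δ`, so it disappears in
the limit once integrated against a compactly supported weight. -/
theorem two_sub_le_softSqDeriv₂ (hδ : 0 < δ) (y : ℝ) : 2 - 3 * (δ * y ^ 2) ≤ softSqDeriv₂ δ y := by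
  have h0 := one_add_mul_sq_pos hδ y
  have h1 := Real.sqrt_pos.2 h0
  have hs := Real.sq_sqrt h0.le
  have hz : 0 ≤ δ * y ^ 2 := by positivity
  unfold softSqDeriv₂
  rw [le_div_iff₀ (by positivity)]
  set z := δ * y ^ 2
  have hle : √(1 + z) ≤ 1 + z / 2 := by
    rw [Real.sqrt_le_left (by positivity)]
    nlinarith
  rcases le_or_gt (2 - 3 * z) 0 with h | h
  · have : (2 - 3 * z) * ((1 + z) * √(1 + z)) ≤ 0 :=
      mul_nonpos_of_nonpos_of_nonneg h (by positivity)
    linarith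
  · calc (2 - 3 * z) * ((1 + z) * √(1 + z)) ≤ (2 - 3 * z) * ((1 + z) * (1 + z / 2)) := by gcongr
      _ ≤ 2 := by nlinarith [mul_nonneg hz hz, mul_nonneg hz (mul_nonneg hz hz)]

/-- The quotient form of `softSq` remains continuous at `δ = 0`, where it equals the square. -/
theorem tendsto_softSq (y : ℝ) :
    Tendsto (fun n : ℕ => softSq (1 / ((n : ℝ) + 1)) y) atTop (𝓝 (y ^ 2)) := by
  have h : Tendsto (fun n : ℕ => 1 / ((n : ℝ) + 1)) atTop (𝓝 0) :=
    tendsto_one_div_add_atTop_nhds_zero_nat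
  have hc : ContinuousAt (fun δ : ℝ => softSq δ y) 0 := by
    unfold softSq
    exact ContinuousAt.div (by fun_prop) (by fun_prop) (by positivity)
  have := hc.tendsto.comp h
  have e : softSq 0 y = y ^ 2 := by
    unfold softSq; simp; ring
  rwa [e] at this

end softSq

/-! ### Cutoffs, and the time derivative of the localized regularized energy. -/

theorem exists_cutoff_seq (d : ℕ) : ∃ (C : ℝ) (χ : ℕ → E d → ℝ), 0 ≤ C ∧ ∀ n,
    ContDiff ℝ 1 (χ n) ∧ HasCompactSupport (χ n) ∧ (∀ x, 0 ≤ χ n x) ∧ (∀ x, χ n x ≤ 1) ∧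
      (∀ x, ‖x‖ ≤ n + 1 → χ n x = 1) ∧ ∀ x, ‖fderiv ℝ (χ n) x‖ ≤ C / (n + 1) := by
  let b : ContDiffBump (0 : E d) := ⟨1, 2, one_pos, one_lt_two⟩
  have hb1 : ContDiff ℝ 1 b := b.contDiff
  obtain ⟨C, hC⟩ := (hb1.continuous_fderiv one_ne_zero).bounded_above_of_compact_support
    (b.hasCompactSupport.fderiv ℝ)
  have hC0 : 0 ≤ C := (norm_nonneg _).trans (hC 0)
  refine ⟨C, fun n x => b (((n : ℝ) + 1)⁻¹ • x), hC0, fun n => ?_⟩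
  have hn : (0 : ℝ) < n + 1 := by positivity
  refine ⟨hb1.comp (contDiff_const_smul _), ?_, fun x => b.nonneg, fun x => b.le_one, ?_, ?_⟩
  · exact b.hasCompactSupport.comp_smul (inv_ne_zero hn.ne')
  · intro x hx
    refine b.one_of_mem_closedBall ?_
    rw [mem_closedBall_zero_iff, norm_smul, norm_inv, Real.norm_of_nonneg hn.le,
      inv_mul_le_iff₀ hn]
    simpa [b] using hx
  · intro x
    have : HasFDerivAt (fun x : E d => b (((n : ℝ) + 1)⁻¹ • x))
        ((fderiv ℝ b (((n : ℝ) + 1)⁻¹ • x)).comp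
          (((n : ℝ) + 1)⁻¹ • ContinuousLinearMap.id ℝ (E d))) x :=
      ((hb1.differentiable one_ne_zero) _).hasFDerivAt.comp x
        ((hasFDerivAt_id x).const_smul ((n : ℝ) + 1)⁻¹)
    rw [this.fderiv, ContinuousLinearMap.comp_smul, ContinuousLinearMap.comp_id, norm_smul,
      norm_inv, Real.norm_of_nonneg hn.le, inv_mul_eq_div]
    exact div_le_div_of_nonneg_right (hC _) hn.le

namespace IsRegularFlow

variable {d : ℕ} {f : E d → ℝ} {g : ℝ → E d → ℝ} {G : ℝ → E d → E d}

theorem continuousOn_diff (h : IsRegularFlow f g G) :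
    ContinuousOn (fun p : ℝ × E d => g p.1 p.2 - f p.2) (Ioi 0 ×ˢ univ) :=
  h.continuousOn.sub (h.target_continuous.comp continuous_snd).continuousOn

theorem continuous_diff (h : IsRegularFlow f g G) {t : ℝ} (ht : 0 < t) :
    Continuous fun x => g t x - f x :=
  (h.continuous_density ht).sub h.target_continuous

theorem contDiff_diff (h : IsRegularFlow f g G) {t : ℝ} (ht : 0 < t) :
    ContDiff ℝ 1 fun x => g t x - f x := by
  rw [contDiff_one_iff_fderiv]
  refine ⟨fun x => (h.hasGradientAt t ht x).differentiableAt, ?_⟩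
  have : (fderiv ℝ fun x => g t x - f x) = fun x => InnerProductSpace.toDual ℝ (E d) (G t x) :=
    funext fun x => (h.hasGradientAt t ht x).hasFDerivAt.fderiv
  rw [this]
  exact (InnerProductSpace.toDual ℝ (E d)).continuous.comp (h.continuous_gradient ht)

theorem contDiff_softSqDeriv {δ : ℝ} (hδ : 0 < δ) : ContDiff ℝ 1 (softSqDeriv δ) := by
  rw [contDiff_one_iff_deriv]
  refine ⟨fun y => (hasDerivAt_softSqDeriv hδ y).differentiableAt, ?_⟩
  have : deriv (softSqDeriv δ) = softSqDeriv₂ δ := funext fun y => (hasDerivAt_softSqDeriv hδ y).deriv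
  rw [this]
  exact continuous_softSqDeriv₂ hδ

/-- These are the test functions of the energy argument. Known to be only `C¹`, like `g s - f`, they
require the weak equation beyond smooth functions. -/
theorem contDiff_cutoff_mul (h : IsRegularFlow f g G) {χ : E d → ℝ} (hχ : ContDiff ℝ 1 χ)
    {δ : ℝ} (hδ : 0 < δ) {s : ℝ} (hs : 0 < s) :
    ContDiff ℝ 1 fun x => χ x * softSqDeriv δ (g s x - f x) :=
  hχ.mul ((contDiff_softSqDeriv hδ).comp (h.contDiff_diff hs))

theorem fderiv_cutoff_mul (h : IsRegularFlow f g G) {χ : E d → ℝ} (hχ : ContDiff ℝ 1 χ)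
    {δ : ℝ} (hδ : 0 < δ) {s : ℝ} (hs : 0 < s) (x v : E d) :
    fderiv ℝ (fun x => χ x * softSqDeriv δ (g s x - f x)) x v =
      softSqDeriv δ (g s x - f x) * fderiv ℝ χ x v +
        χ x * (softSqDeriv₂ δ (g s x - f x) * inner ℝ (G s x) v) := by
  have d1 := ((hχ.differentiable one_ne_zero) x).hasFDerivAt
  have d2 := (hasDerivAt_softSqDeriv hδ (g s x - f x)).comp_hasFDerivAt x
    (h.hasGradientAt s hs x).hasFDerivAt
  have := (d1.mul d2).fderiv
  simp only [Function.comp_def] at this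
  have e : (fun x => χ x * softSqDeriv δ (g s x - f x)) = (χ * fun x => softSqDeriv δ (g s x - f x)) :=
    rfl
  rw [e, this]
  simp
  ring

/-- The flux integral at time `τ` of the test function built from the state at time `s`. -/
noncomputable def crossFlux (f : E d → ℝ) (g : ℝ → E d → ℝ) (G : ℝ → E d → E d) (χ : E d → ℝ)
    (δ s τ : ℝ) : ℝ :=
  fluxIntegral g G (fun x => χ x * softSqDeriv δ (g s x - f x)) τ

/-- Joint continuity in the two times makes the upper and lower convexity bounds agree to first
order at `(t, t)`. -/
theorem continuousOn_crossFlux (h : IsRegularFlow f g G) {χ : E d → ℝ} (hχ : ContDiff ℝ 1 χ)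
    (hc : HasCompactSupport χ) {δ : ℝ} (hδ : 0 < δ) :
    ContinuousOn (fun p : ℝ × ℝ => crossFlux f g G χ δ p.1 p.2) (Ioi 0 ×ˢ Ioi 0) := by
  have key : ContinuousOn (fun p : ℝ × ℝ => ∫ x, (softSqDeriv δ (g p.1 x - f x) *
      fderiv ℝ χ x (G p.2 x) + χ x * (softSqDeriv₂ δ (g p.1 x - f x) * inner ℝ (G p.1 x) (G p.2 x)))
        * g p.2 x) (Ioi 0 ×ˢ Ioi 0) := by
    refine continuousOn_integral_of_compact_support hc.isCompact ?_ ?_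
    · have m1 : ContinuousOn (fun q : (ℝ × ℝ) × E d => (q.1.1, q.2)) ((Ioi 0 ×ˢ Ioi 0) ×ˢ univ) := by
        fun_prop
      have m2 : ContinuousOn (fun q : (ℝ × ℝ) × E d => (q.1.2, q.2)) ((Ioi 0 ×ˢ Ioi 0) ×ˢ univ) := by
        fun_prop
      have t1 : MapsTo (fun q : (ℝ × ℝ) × E d => (q.1.1, q.2)) ((Ioi 0 ×ˢ Ioi 0) ×ˢ univ)
        (Ioi 0 ×ˢ univ) := fun q hq => ⟨hq.1.1, mem_univ _⟩
      have t2 : MapsTo (fun q : (ℝ × ℝ) × E d => (q.1.2, q.2)) ((Ioi 0 ×ˢ Ioi 0) ×ˢ univ)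
        (Ioi 0 ×ˢ univ) := fun q hq => ⟨hq.1.2, mem_univ _⟩
      have w1 := h.continuousOn_diff.comp m1 t1
      have G1 := h.continuousOn_gradient.comp m1 t1
      have G2 := h.continuousOn_gradient.comp m2 t2
      have g2 := h.continuousOn.comp m2 t2
      have c1 : ContinuousOn (fun q : (ℝ × ℝ) × E d => χ q.2) ((Ioi 0 ×ˢ Ioi 0) ×ˢ univ) :=
        (hχ.continuous.comp continuous_snd).continuousOn
      have c2 : ContinuousOn (fun q : (ℝ × ℝ) × E d => fderiv ℝ χ q.2) ((Ioi 0 ×ˢ Ioi 0) ×ˢ univ) :=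
        ((hχ.continuous_fderiv one_ne_zero).comp continuous_snd).continuousOn
      exact ((((continuous_softSqDeriv hδ).comp_continuousOn w1).mul (c2.clm_apply G2)).add
        (c1.mul (((continuous_softSqDeriv₂ hδ).comp_continuousOn w1).mul (G1.inner G2)))).mul g2
    · intro p x _ hx
      rw [image_eq_zero_of_notMem_tsupport hx,
        image_eq_zero_of_notMem_tsupport fun h' => hx (tsupport_fderiv_subset ℝ h')]
      simp
  refine key.congr fun p hp => ?_
  simp only [crossFlux, fluxIntegral]
  congr 1
  funext x
  rw [h.fderiv_cutoff_mul hχ hδ hp.1]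

theorem intervalIntegrable_crossFlux (h : IsRegularFlow f g G) {χ : E d → ℝ} (hχ : ContDiff ℝ 1 χ)
    (hc : HasCompactSupport χ) {δ : ℝ} (hδ : 0 < δ) {r s t : ℝ} (hr : 0 < r) (hs : 0 < s)
    (ht : 0 < t) :
    IntervalIntegrable (fun τ => -2 * crossFlux f g G χ δ r τ) volume s t := by
  have hpos : uIcc s t ⊆ Ioi 0 := fun x hx => lt_of_lt_of_le (lt_min hs ht) hx.1
  have : ContinuousOn (fun τ => crossFlux f g G χ δ r τ) (uIcc s t) :=
    (h.continuousOn_crossFlux hχ hc hδ).comp (f := fun τ => (r, τ)) (by fun_prop)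
      fun τ hτ => ⟨hr, hpos hτ⟩
  exact (continuousOn_const.mul this).intervalIntegrable

theorem integrable_cutoff_softSq (h : IsRegularFlow f g G) {χ : E d → ℝ} (hχ : Continuous χ)
    (hc : HasCompactSupport χ) {δ : ℝ} (hδ : 0 < δ) {t : ℝ} (ht : 0 < t) :
    Integrable fun x => χ x * softSq δ (g t x - f x) :=
  (hχ.mul ((continuous_softSq hδ).comp
    (h.continuous_diff ht))).integrable_of_hasCompactSupport hc.mul_right

/-- The convexity bound for the localized regularized energy. -/
theorem integral_crossFlux_le (h : IsRegularFlow f g G) {χ : E d → ℝ} (hχ : ContDiff ℝ 1 χ)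
    (hc : HasCompactSupport χ) (hχ0 : ∀ x, 0 ≤ χ x) {δ : ℝ} (hδ : 0 < δ) {s t : ℝ} (hs : 0 < s)
    (ht : 0 < t) :
    ∫ τ in s..t, -2 * crossFlux f g G χ δ s τ ≤
      (∫ x, χ x * softSq δ (g t x - f x)) - ∫ x, χ x * softSq δ (g s x - f x) := by
  have hP := h.contDiff_cutoff_mul hχ hδ hs
  have hPc : HasCompactSupport fun x => χ x * softSqDeriv δ (g s x - f x) := hc.mul_right
  have e := h.integral_mul_sub hP hPc hs ht
  simp only [crossFlux]
  rw [← e, ← integral_sub (h.integrable_mul_of_hasCompactSupport ht hP.continuous hPc)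
    (h.integrable_mul_of_hasCompactSupport hs hP.continuous hPc),
    ← integral_sub (h.integrable_cutoff_softSq hχ.continuous hc hδ ht)
      (h.integrable_cutoff_softSq hχ.continuous hc hδ hs)]
  refine integral_mono ?_ ?_ fun x => ?_
  · exact (h.integrable_mul_of_hasCompactSupport ht hP.continuous hPc).sub
      (h.integrable_mul_of_hasCompactSupport hs hP.continuous hPc)
  · exact (h.integrable_cutoff_softSq hχ.continuous hc hδ ht).sub
      (h.integrable_cutoff_softSq hχ.continuous hc hδ hs)
  · have := mul_le_mul_of_nonneg_left (softSq_add_le hδ (g s x - f x) (g t x - f x)) (hχ0 x)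
    simp only
    linarith

/-- Convexity with base point `t`, and then with base point `s`, squeezes the energy increment
between the integrals over `t..s` of the fluxes tested with the states at `t` and at `s`. Both are
`(s - t) (-2 crossFlux t t) + o(s - t)`, so no time derivative of `g` is needed. -/
theorem hasDerivAt_integral_softSq (h : IsRegularFlow f g G) {χ : E d → ℝ} (hχ : ContDiff ℝ 1 χ)
    (hc : HasCompactSupport χ) (hχ0 : ∀ x, 0 ≤ χ x) {δ : ℝ} (hδ : 0 < δ) {t : ℝ} (ht : 0 < t) :
    HasDerivAt (fun s => ∫ x, χ x * softSq δ (g s x - f x)) (-2 * crossFlux f g G χ δ t t) t := by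
  rw [hasDerivAt_iff_isLittleO, Asymptotics.isLittleO_iff]
  intro c hc0
  have hcont : ContinuousAt (fun p : ℝ × ℝ => crossFlux f g G χ δ p.1 p.2) (t, t) :=
    (h.continuousOn_crossFlux hχ hc hδ).continuousAt
      (prod_mem_nhds (Ioi_mem_nhds ht) (Ioi_mem_nhds ht))
  obtain ⟨η, hη, hball⟩ := Metric.continuousAt_iff.1 hcont (c / 2) (by positivity)
  filter_upwards [Metric.ball_mem_nhds t (show 0 < min η t by positivity)] with s hs
  have hst : |s - t| < min η t := by simpa [Real.dist_eq] using hs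
  have hs0 : 0 < s := by
    have := (abs_lt.1 (hst.trans_le (min_le_right _ _))).1
    linarith
  have near : ∀ r, |r - t| ≤ |s - t| → ∀ τ ∈ uIoc t s,
      ‖-2 * crossFlux f g G χ δ r τ - -2 * crossFlux f g G χ δ t t‖ ≤ c := by
    intro r hr τ hτ
    have hτ' : |τ - t| ≤ |s - t| := abs_sub_left_of_mem_uIcc (uIoc_subset_uIcc hτ)
    have : dist (r, τ) (t, t) < η := by
      rw [Prod.dist_eq, Real.dist_eq, Real.dist_eq]
      exact max_lt (hr.trans_lt (hst.trans_le (min_le_left _ _)))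
        (hτ'.trans_lt (hst.trans_le (min_le_left _ _)))
    have := (hball this).le
    rw [Real.dist_eq] at this
    rw [Real.norm_eq_abs, ← mul_sub, abs_mul]
    norm_num
    linarith
  have est : ∀ r, 0 < r → |r - t| ≤ |s - t| →
      |(∫ τ in t..s, -2 * crossFlux f g G χ δ r τ) - (s - t) * (-2 * crossFlux f g G χ δ t t)|
        ≤ c * |s - t| := by
    intro r hr0 hr
    have := intervalIntegral.norm_integral_le_of_norm_le_const (near r hr)
    rwa [intervalIntegral.integral_sub (h.intervalIntegrable_crossFlux hχ hc hδ hr0 ht hs0)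
      intervalIntegrable_const, intervalIntegral.integral_const, smul_eq_mul] at this
  have lo := h.integral_crossFlux_le hχ hc hχ0 hδ ht hs0
  have hi := h.integral_crossFlux_le hχ hc hχ0 hδ hs0 ht
  rw [intervalIntegral.integral_symm] at hi
  have e1 := abs_le.1 (est t ht (by simp))
  have e2 := abs_le.1 (est s hs0 le_rfl)
  rw [smul_eq_mul, Real.norm_eq_abs, Real.norm_eq_abs, abs_le]
  constructor <;> linarith

theorem integral_softSq_sub (h : IsRegularFlow f g G) {χ : E d → ℝ} (hχ : ContDiff ℝ 1 χ)
    (hc : HasCompactSupport χ) (hχ0 : ∀ x, 0 ≤ χ x) {δ : ℝ} (hδ : 0 < δ) {s t : ℝ} (hs : 0 < s)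
    (ht : 0 < t) :
    (∫ x, χ x * softSq δ (g s x - f x)) - ∫ x, χ x * softSq δ (g t x - f x) =
      ∫ τ in s..t, 2 * crossFlux f g G χ δ τ τ := by
  have hpos : uIcc s t ⊆ Ioi 0 := fun x hx => lt_of_lt_of_le (lt_min hs ht) hx.1
  have hcont : ContinuousOn (fun τ => crossFlux f g G χ δ τ τ) (uIcc s t) :=
    (h.continuousOn_crossFlux hχ hc hδ).comp (f := fun τ => (τ, τ)) (by fun_prop)
      fun τ hτ => ⟨hpos hτ, hpos hτ⟩
  have := intervalIntegral.integral_eq_sub_of_hasDerivAt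
    (fun τ hτ => h.hasDerivAt_integral_softSq hχ hc hχ0 hδ (hpos hτ))
    (continuousOn_const.mul hcont).intervalIntegrable
  rw [intervalIntegral.integral_const_mul] at this ⊢
  linarith

end IsRegularFlow

/-! ### The energy dissipation inequality. -/

/-- Cauchy-Schwarz for the probability measure of density `p`, after splitting `p` into two square
roots. -/
theorem lintegral_mul_density_le {d : ℕ} {p : E d → ℝ} (hp : IsProbDensity p) {k : E d → ENNReal}
    (hk : AEMeasurable k) :
    ∫⁻ x, k x * ENNReal.ofReal (p x) ≤
      (∫⁻ x, k x ^ 2 * ENNReal.ofReal (p x)) ^ (1 / 2 : ℝ) := by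
  have hm : AEMeasurable fun x => ENNReal.ofReal (p x) ^ (1 / 2 : ℝ) :=
    hp.integrable.aemeasurable.ennreal_ofReal.pow_const _
  have h1 : ∫⁻ x, ENNReal.ofReal (p x) = 1 := by
    rw [← ofReal_integral_eq_lintegral_ofReal hp.integrable (ae_of_all _ hp.nonneg),
      hp.integral_eq_one, ENNReal.ofReal_one]
  have sq : ∀ a : ENNReal, (a ^ (1 / 2 : ℝ)) ^ (2 : ℝ) = a := fun a => by
    rw [← ENNReal.rpow_mul]; norm_num
  have key := ENNReal.lintegral_mul_le_Lp_mul_Lq volume Real.HolderConjugate.two_two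
    (hk.mul hm) hm
  simp only [Pi.mul_apply, sq, h1, ENNReal.one_rpow, mul_one] at key
  have e1 : ∀ a b : ENNReal, (a * b ^ (1 / 2 : ℝ)) * b ^ (1 / 2 : ℝ) = a * b := fun a b => by
    rw [mul_assoc, ← pow_two, ← ENNReal.rpow_two, sq]
  have e2 : ∀ a b : ENNReal, (a * b ^ (1 / 2 : ℝ)) ^ (2 : ℝ) = a ^ 2 * b := fun a b => by
    rw [ENNReal.mul_rpow_of_nonneg _ _ zero_le_two, sq, ENNReal.rpow_two]
  simpa only [e1, e2] using key

namespace IsRegularFlow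

variable {d : ℕ} {f : E d → ℝ} {g : ℝ → E d → ℝ} {G : ℝ → E d → E d}

theorem memLp_diff (h : IsRegularFlow f g G) {t : ℝ} (ht : 0 < t) :
    MemLp (fun x => g t x - f x) 2 := (h.memLp t ht).sub h.target_memLp

theorem continuousOn_integral_weight_dissipation (h : IsRegularFlow f g G) {χ : E d → ℝ}
    (hχ : Continuous χ) (hc : HasCompactSupport χ) {k : ℝ → E d → ℝ}
    (hk : ContinuousOn (fun p : ℝ × E d => k p.1 p.2) (Ioi 0 ×ˢ univ)) :
    ContinuousOn (fun τ => ∫ x, χ x * (k τ x * ‖G τ x‖ ^ 2 * g τ x)) (Ioi 0) := by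
  refine continuousOn_integral_of_compact_support hc.isCompact ?_ ?_
  · exact (hχ.comp continuous_snd).continuousOn.mul
      ((hk.mul (h.continuousOn_gradient.norm.pow 2)).mul h.continuousOn)
  · intro t x _ hx
    rw [image_eq_zero_of_notMem_tsupport hx, zero_mul]

theorem integrable_weight_dissipation (h : IsRegularFlow f g G) {χ : E d → ℝ}
    (hχ : Continuous χ) (hc : HasCompactSupport χ) {t : ℝ} (ht : 0 < t) {k : E d → ℝ}
    (hk : Continuous k) :
    Integrable fun x => χ x * (k x * ‖G t x‖ ^ 2 * g t x) :=
  (hχ.mul ((hk.mul ((h.continuous_gradient ht).norm.pow 2)).mul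
    (h.continuous_density ht))).integrable_of_hasCompactSupport hc.mul_right

/-- The part of the flux that comes from the gradient of the cutoff. -/
noncomputable def cutoffFlux (f : E d → ℝ) (g : ℝ → E d → ℝ) (G : ℝ → E d → E d) (χ : E d → ℝ)
    (δ τ : ℝ) : ℝ :=
  ∫ x, softSqDeriv δ (g τ x - f x) * fderiv ℝ χ x (G τ x) * g τ x

theorem continuousOn_cutoffFlux (h : IsRegularFlow f g G) {χ : E d → ℝ} (hχ : ContDiff ℝ 1 χ)
    (hc : HasCompactSupport χ) {δ : ℝ} (hδ : 0 < δ) :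
    ContinuousOn (cutoffFlux f g G χ δ) (Ioi 0) := by
  refine continuousOn_integral_of_compact_support (hc.fderiv ℝ).isCompact ?_ ?_
  · have c2 : ContinuousOn (fun q : ℝ × E d => fderiv ℝ χ q.2) (Ioi 0 ×ˢ univ) :=
      ((hχ.continuous_fderiv one_ne_zero).comp continuous_snd).continuousOn
    exact (((continuous_softSqDeriv hδ).comp_continuousOn h.continuousOn_diff).mul
      (c2.clm_apply h.continuousOn_gradient)).mul h.continuousOn
  · intro t x _ hx
    rw [image_eq_zero_of_notMem_tsupport hx]
    simp

theorem crossFlux_self (h : IsRegularFlow f g G) {χ : E d → ℝ} (hχ : ContDiff ℝ 1 χ)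
    (hc : HasCompactSupport χ) {δ : ℝ} (hδ : 0 < δ) {t : ℝ} (ht : 0 < t) :
    crossFlux f g G χ δ t t = cutoffFlux f g G χ δ t +
      ∫ x, χ x * (softSqDeriv₂ δ (g t x - f x) * ‖G t x‖ ^ 2 * g t x) := by
  unfold crossFlux fluxIntegral cutoffFlux
  rw [← integral_add]
  · congr 1
    funext x
    rw [h.fderiv_cutoff_mul hχ hδ ht, real_inner_self_eq_norm_sq]
    ring
  · refine Continuous.integrable_of_hasCompactSupport ?_ ?_
    · exact (((continuous_softSqDeriv hδ).comp (h.continuous_diff ht)).mul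
        ((hχ.continuous_fderiv one_ne_zero).clm_apply (h.continuous_gradient ht))).mul
          (h.continuous_density ht)
    · refine (hc.fderiv ℝ).mono' fun x hx => subset_tsupport _ fun h0 => hx ?_
      simp [h0]
  · exact h.integrable_weight_dissipation hχ.continuous hc ht
      ((continuous_softSqDeriv₂ hδ).comp (h.continuous_diff ht))

/-- The reason for regularizing the square: with slope at most `2 / √δ`, the cutoff error costs only
the mean speed, which the definition of the flow makes integrable in time. -/
theorem enorm_cutoffFlux_le (h : IsRegularFlow f g G) {χ : E d → ℝ} {C : ℝ}
    (hχ : ∀ x, ‖fderiv ℝ χ x‖ ≤ C) {δ : ℝ} (hδ : 0 < δ) {t : ℝ} (ht : 0 < t) :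
    ‖cutoffFlux f g G χ δ t‖ₑ ≤ ENNReal.ofReal (2 / √δ * C) *
      (∫⁻ x, ‖-(2 : ℝ) • G t x‖ₑ ^ 2 * ENNReal.ofReal (g t x)) ^ (1 / 2 : ℝ) := by
  have hC : 0 ≤ C := (norm_nonneg _).trans (hχ 0)
  have hD : 0 ≤ 2 / √δ * C := by positivity
  calc ‖cutoffFlux f g G χ δ t‖ₑ
      ≤ ∫⁻ x, ‖softSqDeriv δ (g t x - f x) * fderiv ℝ χ x (G t x) * g t x‖ₑ :=
        enorm_integral_le_lintegral_enorm _
    _ ≤ ∫⁻ x, ENNReal.ofReal (2 / √δ * C) * (‖-(2 : ℝ) • G t x‖ₑ * ENNReal.ofReal (g t x)) := by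
        refine lintegral_mono fun x => ?_
        have hg := (h.density t ht).nonneg x
        rw [← ofReal_norm, ← ofReal_norm,
          ← ENNReal.ofReal_mul (norm_nonneg _), ← ENNReal.ofReal_mul hD]
        refine ENNReal.ofReal_le_ofReal ?_
        rw [norm_mul, norm_mul, Real.norm_of_nonneg hg, Real.norm_eq_abs, ← mul_assoc, mul_assoc (2 / √δ)]
        refine mul_le_mul_of_nonneg_right (mul_le_mul (abs_softSqDeriv_le hδ _) ?_
          (norm_nonneg _) (by positivity)) hg
        refine (ContinuousLinearMap.le_opNorm _ _).trans
          (mul_le_mul (hχ x) ?_ (norm_nonneg _) hC)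
        rw [norm_smul]
        norm_num
        linarith [norm_nonneg (G t x)]
    _ = ENNReal.ofReal (2 / √δ * C) * ∫⁻ x, ‖-(2 : ℝ) • G t x‖ₑ * ENNReal.ofReal (g t x) :=
        lintegral_const_mul' _ _ ENNReal.ofReal_ne_top
    _ ≤ _ := mul_le_mul' le_rfl (lintegral_mul_density_le (h.density t ht)
        (k := fun x => ‖-(2 : ℝ) • G t x‖ₑ)
        ((h.continuous_gradient ht).const_smul (-(2 : ℝ))).enorm.aemeasurable)

theorem tendsto_integral_cutoff_softSq (h : IsRegularFlow f g G) {χ : ℕ → E d → ℝ}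
    (h1 : ∀ n, Continuous (χ n)) (h2 : ∀ n x, 0 ≤ χ n x) (h3 : ∀ n x, χ n x ≤ 1)
    (h4 : ∀ (n : ℕ) x, ‖x‖ ≤ n + 1 → χ n x = 1) {t : ℝ} (ht : 0 < t) :
    Tendsto (fun n : ℕ => ∫ x, χ n x * softSq (1 / ((n : ℝ) + 1)) (g t x - f x)) atTop
      (𝓝 (sqL2Dist f (g t))) := by
  unfold sqL2Dist
  refine tendsto_integral_of_dominated_convergence (fun x => (g t x - f x) ^ 2) (fun n => ?_)
    (h.memLp_diff ht).integrable_sq (fun n => ae_of_all _ fun x => ?_) (ae_of_all _ fun x => ?_)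
  · exact ((h1 n).mul ((continuous_softSq (by positivity)).comp
      (h.continuous_diff ht))).aestronglyMeasurable
  · have hs := softSq_nonneg (1 / ((n : ℝ) + 1)) (g t x - f x)
    rw [Real.norm_of_nonneg (mul_nonneg (h2 n x) hs)]
    exact (mul_le_of_le_one_left hs (h3 n x)).trans (softSq_le_sq (by positivity) _)
  · refine (tendsto_softSq (g t x - f x)).congr' ?_
    obtain ⟨N, hN⟩ := exists_nat_ge ‖x‖
    filter_upwards [eventually_ge_atTop N] with n hn
    have : (N : ℝ) ≤ n := by exact_mod_cast hn
    rw [h4 n x (by linarith), one_mul]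

/-- The energy dissipation inequality, localized by a cutoff. -/
theorem integral_dissipation_le (h : IsRegularFlow f g G) {χ : E d → ℝ} (hχ : Continuous χ)
    (hc : HasCompactSupport χ) (hχ0 : ∀ x, 0 ≤ χ x) (hχ1 : ∀ x, χ x ≤ 1) {s t : ℝ} (hs : 0 < s)
    (hst : s ≤ t) :
    ∫ τ in s..t, 4 * ∫ x, χ x * (1 * ‖G τ x‖ ^ 2 * g τ x) ≤
      sqL2Dist f (g s) - sqL2Dist f (g t) := by
  have ht : 0 < t := hs.trans_le hst
  have hpos : uIcc s t ⊆ Ioi 0 := fun x hx => lt_of_lt_of_le (lt_min hs ht) hx.1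
  obtain ⟨C, η, hC, hη⟩ := exists_cutoff_seq d
  choose a1 a2 a3 a4 a5 a6 using hη
  set J : ℝ → ℝ := fun τ => ∫ x, χ x * (1 * ‖G τ x‖ ^ 2 * g τ x) with hJ
  set H : ℝ → ℝ := fun τ => ∫ x, χ x * ((g τ x - f x) ^ 2 * ‖G τ x‖ ^ 2 * g τ x) with hH
  have hJc : ContinuousOn J (Ioi 0) :=
    h.continuousOn_integral_weight_dissipation hχ hc continuousOn_const
  have hHc : ContinuousOn H (Ioi 0) :=
    h.continuousOn_integral_weight_dissipation hχ hc (h.continuousOn_diff.pow 2)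
  have hsp := (h.speed s t hs).ne
  set A := ∫⁻ τ in Icc s t, (∫⁻ x, ‖-(2 : ℝ) • G τ x‖ₑ ^ 2 * ENNReal.ofReal (g τ x)) ^ (1 / 2 : ℝ)
    with hA
  -- The weight `χ` stays fixed while `η n` exhausts space. Once `η n ≥ χ`, the nonnegative
  -- dissipation weighted by `η n` dominates the one weighted by `χ`.
  have main : ∀ᶠ n : ℕ in atTop, (∫ τ in s..t, 4 * J τ) -
      6 * (1 / ((n : ℝ) + 1)) * (∫ τ in s..t, H τ) - 4 * C * A.toReal * √(1 / ((n : ℝ) + 1)) ≤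
      (∫ x, η n x * softSq (1 / ((n : ℝ) + 1)) (g s x - f x)) -
        ∫ x, η n x * softSq (1 / ((n : ℝ) + 1)) (g t x - f x) := by
    obtain ⟨R, hR⟩ := hc.isCompact.isBounded.subset_closedBall 0
    obtain ⟨N, hN⟩ := exists_nat_ge R
    filter_upwards [eventually_ge_atTop N] with n hn
    have hn' : R ≤ n + 1 := by
      have : (N : ℝ) ≤ n := by exact_mod_cast hn
      linarith
    have hχη : ∀ x, χ x ≤ η n x := by
      intro x
      by_cases hx : x ∈ tsupport χ
      · rw [a5 n x ((by simpa using hR hx : ‖x‖ ≤ R).trans hn')]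
        exact hχ1 x
      · rw [image_eq_zero_of_notMem_tsupport hx]
        exact a3 n x
    have hn0 : (0 : ℝ) < n + 1 := by positivity
    -- The cutoff gradient is of order `δ` and the slope of order `1 / √δ`, so this coupling leaves
    -- an error of order `√δ`.
    set δ : ℝ := 1 / ((n : ℝ) + 1) with hδd
    have hδ : 0 < δ := by positivity
    rw [h.integral_softSq_sub (a1 n) (a2 n) (a3 n) hδ hs ht]
    have hcut := h.continuousOn_cutoffFlux (a1 n) (a2 n) hδ
    have err : |∫ τ in s..t, cutoffFlux f g G (η n) δ τ| ≤ 2 / √δ * (C / (n + 1)) * A.toReal := by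
      have hk : 0 ≤ 2 / √δ * (C / (n + 1)) := by positivity
      rw [intervalIntegral.integral_of_le hst, ← Real.norm_eq_abs, ← toReal_enorm,
        ← ENNReal.toReal_ofReal hk, ← ENNReal.toReal_mul]
      refine ENNReal.toReal_mono (ENNReal.mul_ne_top ENNReal.ofReal_ne_top hsp) ?_
      refine (enorm_integral_le_lintegral_enorm _).trans ?_
      rw [hA, ← lintegral_const_mul' _ _ ENNReal.ofReal_ne_top]
      refine (lintegral_mono_set Ioc_subset_Icc_self).trans ?_
      refine setLIntegral_mono' measurableSet_Icc fun τ hτ => ?_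
      exact h.enorm_cutoffFlux_le (a6 n) hδ (hs.trans_le hτ.1)
    have err' : 2 / √δ * (C / (n + 1)) * A.toReal = 2 * C * A.toReal * √δ := by
      have h1 : C / (n + 1) = C * δ := by rw [hδd]; ring
      have h2 := Real.mul_self_sqrt hδ.le
      have h3 : √δ ≠ 0 := (Real.sqrt_pos.2 hδ).ne'
      rw [h1]
      field_simp
      linear_combination (-1) * C * A.toReal * h2
    rw [err'] at err
    have low : ∀ τ, 0 < τ → cutoffFlux f g G (η n) δ τ + (2 * J τ - 3 * δ * H τ) ≤
        crossFlux f g G (η n) δ τ τ := by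
      intro τ hτ
      rw [h.crossFlux_self (a1 n) (a2 n) hδ hτ]
      have iJ := h.integrable_weight_dissipation hχ hc hτ (continuous_const (y := (1 : ℝ)))
      have iH := h.integrable_weight_dissipation hχ hc hτ
        (k := fun x => (g τ x - f x) ^ 2) ((h.continuous_diff hτ).pow 2)
      rw [hJ, hH]
      simp only
      rw [← integral_const_mul, ← integral_const_mul, ← integral_sub (iJ.const_mul 2)
        (iH.const_mul (3 * δ))]
      refine add_le_add le_rfl (integral_mono ((iJ.const_mul 2).sub (iH.const_mul (3 * δ)))
        (h.integrable_weight_dissipation (a1 n).continuous (a2 n) hτ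
          ((continuous_softSqDeriv₂ hδ).comp (h.continuous_diff hτ))) fun x => ?_)
      have b1 := two_sub_le_softSqDeriv₂ hδ (g τ x - f x)
      have b2 := softSqDeriv₂_nonneg hδ (g τ x - f x)
      have b3 : 0 ≤ ‖G τ x‖ ^ 2 * g τ x := mul_nonneg (sq_nonneg _) ((h.density τ hτ).nonneg x)
      calc 2 * (χ x * (1 * ‖G τ x‖ ^ 2 * g τ x)) -
            3 * δ * (χ x * ((g τ x - f x) ^ 2 * ‖G τ x‖ ^ 2 * g τ x))
          = χ x * ((2 - 3 * (δ * (g τ x - f x) ^ 2)) * (‖G τ x‖ ^ 2 * g τ x)) := by ring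
        _ ≤ χ x * (softSqDeriv₂ δ (g τ x - f x) * (‖G τ x‖ ^ 2 * g τ x)) :=
          mul_le_mul_of_nonneg_left (mul_le_mul_of_nonneg_right b1 b3) (hχ0 x)
        _ ≤ η n x * (softSqDeriv₂ δ (g τ x - f x) * (‖G τ x‖ ^ 2 * g τ x)) :=
          mul_le_mul_of_nonneg_right (hχη x) (mul_nonneg b2 b3)
        _ = _ := by ring
    have iC : IntervalIntegrable (cutoffFlux f g G (η n) δ) volume s t :=
      (hcut.mono hpos).intervalIntegrable
    have iJ : IntervalIntegrable (fun τ => 2 * J τ) volume s t :=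
      (continuousOn_const.mul (hJc.mono hpos)).intervalIntegrable
    have iH : IntervalIntegrable (fun τ => 3 * δ * H τ) volume s t :=
      (continuousOn_const.mul (hHc.mono hpos)).intervalIntegrable
    have iX : IntervalIntegrable (fun τ => crossFlux f g G (η n) δ τ τ) volume s t :=
      ((h.continuousOn_crossFlux (a1 n) (a2 n) hδ).comp (f := fun τ => (τ, τ)) (by fun_prop)
        fun τ hτ => ⟨hpos hτ, hpos hτ⟩).intervalIntegrable
    have mono := intervalIntegral.integral_mono_on hst (iC.add (iJ.sub iH)) iX
      fun τ hτ => low τ (hs.trans_le hτ.1)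
    rw [intervalIntegral.integral_add iC (iJ.sub iH), intervalIntegral.integral_sub iJ iH,
      intervalIntegral.integral_const_mul, intervalIntegral.integral_const_mul] at mono
    rw [intervalIntegral.integral_const_mul, intervalIntegral.integral_const_mul]
    have := (abs_le.1 err).1
    linarith
  have l0 : Tendsto (fun n : ℕ => 1 / ((n : ℝ) + 1)) atTop (𝓝 0) :=
    tendsto_one_div_add_atTop_nhds_zero_nat
  have l1 : Tendsto (fun n : ℕ => (∫ τ in s..t, 4 * J τ) -
      6 * (1 / ((n : ℝ) + 1)) * (∫ τ in s..t, H τ) - 4 * C * A.toReal * √(1 / ((n : ℝ) + 1))) atTop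
      (𝓝 ((∫ τ in s..t, 4 * J τ) - 6 * 0 * (∫ τ in s..t, H τ) - 4 * C * A.toReal * √0)) :=
    (tendsto_const_nhds.sub ((l0.const_mul 6).mul_const _)).sub
      (((Real.continuous_sqrt.tendsto 0).comp l0).const_mul _)
  have l2 := (h.tendsto_integral_cutoff_softSq (fun n => (a1 n).continuous) a3 a4 a5 hs).sub
    (h.tendsto_integral_cutoff_softSq (fun n => (a1 n).continuous) a3 a4 a5 ht)
  have l3 := le_of_tendsto_of_tendsto l1 l2 main
  rwa [mul_zero, zero_mul, sub_zero, Real.sqrt_zero, mul_zero, sub_zero] at l3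

/-- The energy plus the accumulated local dissipation is nonincreasing in time. The compact support
of `χ` makes the dissipation continuous in time, so this sum can be differentiated at `t`. -/
theorem dissipation_le_neg_deriv (h : IsRegularFlow f g G) {χ : E d → ℝ} (hχ : Continuous χ)
    (hc : HasCompactSupport χ) (hχ0 : ∀ x, 0 ≤ χ x) (hχ1 : ∀ x, χ x ≤ 1) {t ℓ : ℝ} (ht : 0 < t)
    (hℓ : HasDerivAt (fun s => sqL2Dist f (g s)) ℓ t) :
    4 * ∫ x, χ x * (1 * ‖G t x‖ ^ 2 * g t x) ≤ -ℓ := by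
  set J : ℝ → ℝ := fun τ => ∫ x, χ x * (1 * ‖G τ x‖ ^ 2 * g τ x) with hJ
  have hJc : ContinuousOn J (Ioi 0) :=
    h.continuousOn_integral_weight_dissipation hχ hc continuousOn_const
  have hJ4 : ContinuousOn (fun τ => 4 * J τ) (Ioi 0) := continuousOn_const.mul hJc
  have hi : ∀ {a b : ℝ}, 0 < a → 0 < b → IntervalIntegrable (fun τ => 4 * J τ) volume a b :=
    fun ha hb => (hJ4.mono fun x hx => lt_of_lt_of_le (lt_min ha hb) hx.1).intervalIntegrable
  have d1 : HasDerivAt (fun s => ∫ τ in t..s, 4 * J τ) (4 * J t) t :=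
    intervalIntegral.integral_hasDerivAt_right (hi ht ht)
      (hJ4.stronglyMeasurableAtFilter isOpen_Ioi t ht) (hJ4.continuousAt (Ioi_mem_nhds ht))
  have anti : AntitoneOn ((fun s => sqL2Dist f (g s)) + fun s => ∫ τ in t..s, 4 * J τ) (Ioi 0) := by
    intro a ha b hb hab
    have e := h.integral_dissipation_le hχ hc hχ0 hχ1 ha hab
    have := intervalIntegral.integral_add_adjacent_intervals (hi ht ha) (hi ha hb)
    simp only [Pi.add_apply]
    linarith
  have acc : AccPt t (𝓟 (Ioi (0 : ℝ))) := by
    have : (𝓝[≠] t) ⊓ 𝓟 (Ioi 0) = 𝓝[≠] t :=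
      inf_eq_left.2 (le_principal_iff.2 (mem_nhdsWithin_of_mem_nhds (Ioi_mem_nhds ht)))
    rw [AccPt, this]
    infer_instance
  have := (hℓ.add d1).hasDerivWithinAt.nonpos_of_antitoneOn acc anti
  linarith

/-- Energy dissipation at a time of differentiability. -/
theorem lintegral_dissipation_le (h : IsRegularFlow f g G) {t ℓ : ℝ} (ht : 0 < t)
    (hℓ : HasDerivAt (fun s => sqL2Dist f (g s)) ℓ t) :
    ∫⁻ x, ‖G t x‖ₑ ^ 2 * ENNReal.ofReal (g t x) ≤ ENNReal.ofReal |ℓ| := by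
  obtain ⟨C, η, hC, hη⟩ := exists_cutoff_seq d
  choose a1 a2 a3 a4 a5 a6 using hη
  have hU : (⋃ n : ℕ, Metric.closedBall (0 : E d) n) = univ := Metric.iUnion_closedBall_nat 0
  -- Monotone exhaustion by balls, on the `n`-th of which `η n = 1`.
  rw [← setLIntegral_univ, ← hU, setLIntegral_iUnion_of_directed]
  · refine iSup_le fun n => ?_
    have i := h.integrable_weight_dissipation (a1 n).continuous (a2 n) ht
      (continuous_const (y := (1 : ℝ)))
    have nn : ∀ x, 0 ≤ η n x * (1 * ‖G t x‖ ^ 2 * g t x) := fun x =>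
      mul_nonneg (a3 n x) (mul_nonneg (by positivity) ((h.density t ht).nonneg x))
    have key := h.dissipation_le_neg_deriv (a1 n).continuous (a2 n) (a3 n) (a4 n) ht hℓ
    calc ∫⁻ x in Metric.closedBall (0 : E d) n, ‖G t x‖ₑ ^ 2 * ENNReal.ofReal (g t x)
        ≤ ∫⁻ x in Metric.closedBall (0 : E d) n,
            ENNReal.ofReal (η n x * (1 * ‖G t x‖ ^ 2 * g t x)) := by
          refine setLIntegral_mono' Metric.isClosed_closedBall.measurableSet fun x hx => ?_
          have hx' : ‖x‖ ≤ n := by simpa using hx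
          rw [a5 n x (by linarith), one_mul, one_mul, ENNReal.ofReal_mul (by positivity),
            ENNReal.ofReal_pow (norm_nonneg _), ofReal_norm]
      _ ≤ ∫⁻ x, ENNReal.ofReal (η n x * (1 * ‖G t x‖ ^ 2 * g t x)) := setLIntegral_le_lintegral _ _
      _ = ENNReal.ofReal (∫ x, η n x * (1 * ‖G t x‖ ^ 2 * g t x)) :=
          (ofReal_integral_eq_lintegral_ofReal i (ae_of_all _ nn)).symm
      _ ≤ ENNReal.ofReal |ℓ| := by
          refine ENNReal.ofReal_le_ofReal ?_
          have : 0 ≤ ∫ x, η n x * (1 * ‖G t x‖ ^ 2 * g t x) := integral_nonneg nn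
          linarith [neg_le_abs ℓ]
  · refine directed_of_isDirected_le fun m n hmn => Metric.closedBall_subset_closedBall ?_
    exact_mod_cast hmn

end IsRegularFlow

/-! ### From the gradient flow to its regular form. -/

/-- The additive constant left free in the first variation depends on time only, so it does not
affect the velocity. -/
theorem isRegularFlow_of_isWassersteinGradientFlow {d : ℕ} {f : E d → ℝ} {g : ℝ → E d → ℝ}
    (hf : IsProbDensity f) (hfd : ContDiff ℝ 1 f) (hf2 : MemLp f 2)
    (hg : IsWassersteinGradientFlow (sqL2Dist f) g)
    (hg1 : ∀ t, 0 < t → (∀ x, 0 < g t x) ∧ Differentiable ℝ (g t) ∧ MemLp (g t) 2)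
    (hgc : ContinuousOn (fun p : ℝ × E d => g p.1 p.2) (Ioi 0 ×ˢ univ))
    (hgg : ContinuousOn (fun p : ℝ × E d => gradient (g p.1) p.2) (Ioi 0 ×ˢ univ)) :
    IsRegularFlow f g fun t x => gradient (g t) x - gradient f x := by
  have hfD : Differentiable ℝ f := hfd.differentiable one_ne_zero
  have hfg : Continuous (gradient f) :=
    (InnerProductSpace.toDual ℝ (E d)).symm.continuous.comp (hfd.continuous_fderiv one_ne_zero)
  have hgrad : ∀ t, 0 < t → ∀ x,
      HasGradientAt (fun y => g t y - f y) (gradient (g t) x - gradient f x) x := by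
    intro t ht x
    rw [hasGradientAt_iff_hasFDerivAt, map_sub]
    exact ((hg1 t ht).2.1 x).hasGradientAt.hasFDerivAt.sub (hfD x).hasGradientAt.hasFDerivAt
  obtain ⟨u, hu, hspeed, hcont⟩ := hg.velocity
  have hv : ∀ t, 0 < t → ∀ x,
      -gradient (u t) x = -(2 : ℝ) • (gradient (g t) x - gradient f x) := by
    intro t ht x
    obtain ⟨c, hc⟩ := exists_firstVariation_sqL2Dist_eq hf2 (hg1 t ht).2.2 hfd.continuous
      (hg1 t ht).2.1.continuous (hu t ht).1.continuous (hu t ht).2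
    have e : u t = fun x => 2 * (g t x - f x) + c := funext hc
    have : HasGradientAt (u t) ((2 : ℝ) • (gradient (g t) x - gradient f x)) x := by
      rw [hasGradientAt_iff_hasFDerivAt, map_smulₛₗ, e]
      simpa using ((hgrad t ht x).hasFDerivAt.const_mul 2).add_const c
    rw [this.gradient, neg_smul]
  refine ⟨hf, hfd.continuous, hf2, hg.density, fun t ht => (hg1 t ht).2.2, hgc,
    hgg.sub (hfg.comp continuous_snd).continuousOn, hgrad, ?_, ?_⟩
  · intro a b ha
    refine lt_of_eq_of_lt ?_ (hspeed a b ha)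
    refine setLIntegral_congr_fun measurableSet_Icc fun t ht => ?_
    simp only [hv t (ha.trans_le ht.1)]
  · intro φ h1 h2 h3
    refine Eq.trans ?_ (hcont φ h1 h2 h3)
    refine setIntegral_congr_fun measurableSet_Ioi fun t ht => ?_
    simp only [hv t ht]

/-! ### A Nash type inequality with gradient weighted by `|w|`. -/

theorem hasDerivAt_mul_abs_self (y : ℝ) : HasDerivAt (fun y : ℝ => y * |y|) (2 * |y|) y := by
  rcases lt_trichotomy y 0 with h | rfl | h
  · have : HasDerivAt (fun y : ℝ => -y ^ 2) (2 * |y|) y := by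
      rw [abs_of_neg h]
      convert! ((hasDerivAt_id y).pow 2).neg using 1
      simp
    refine this.congr_of_eventuallyEq ?_
    filter_upwards [Iio_mem_nhds h] with z hz
    rw [abs_of_neg hz]
    ring
  · rw [hasDerivAt_iff_isLittleO]
    simp only [abs_zero, mul_zero, sub_zero, smul_zero]
    rw [Asymptotics.isLittleO_iff]
    intro c hc
    filter_upwards [Metric.ball_mem_nhds (0 : ℝ) hc] with z hz
    have hz' : |z| ≤ c := by simpa using (Metric.mem_ball.1 hz).le
    rw [norm_mul, Real.norm_eq_abs, Real.norm_eq_abs, abs_abs]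
    exact mul_le_mul_of_nonneg_right hz' (abs_nonneg z)
  · have : HasDerivAt (fun y : ℝ => y ^ 2) (2 * |y|) y := by
      rw [abs_of_pos h]
      convert! (hasDerivAt_id y).pow 2 using 1
      simp
    refine this.congr_of_eventuallyEq ?_
    filter_upwards [Ioi_mem_nhds h] with z hz
    rw [abs_of_pos hz]
    ring

/-- For equal signs, `|a² - b²| = |a - b| |a + b| ≥ (a - b)²`; for opposite signs, `(a - b)² ≤ 2 (a²
+ b²)`. The signed square brings in the weight `|w|`, as its derivative along `w` is `2 |w| ∇w`. -/
theorem sub_sq_le_two_mul_abs_sub (a b : ℝ) : (a - b) ^ 2 ≤ 2 * |a * abs a - b * abs b| := by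
  rcases abs_cases a with ⟨h1, h1'⟩ | ⟨h1, h1'⟩ <;>
    rcases abs_cases b with ⟨h2, h2'⟩ | ⟨h2, h2'⟩ <;> rw [h1, h2]
  · rcases le_total a b with h | h
    · rw [abs_of_nonpos (by nlinarith)]; nlinarith
    · rw [abs_of_nonneg (by nlinarith)]; nlinarith
  · rw [abs_of_nonneg (by nlinarith)]; nlinarith [sq_nonneg (a + b)]
  · rw [abs_of_nonpos (by nlinarith)]; nlinarith [sq_nonneg (a + b)]
  · rcases le_total a b with h | h
    · rw [abs_of_nonpos (by nlinarith)]; nlinarith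
    · rw [abs_of_nonneg (by nlinarith)]; nlinarith

section Nash

variable {d : ℕ} {w : E d → ℝ}

/-- The signed square of `w` is integrated along the segment from `x` to `x + y`. One factor `2` of
the `4` comes from comparing squares, the other from the derivative. -/
theorem enorm_translate_sub_sq_le (hw : ContDiff ℝ 1 w) (x y : E d) :
    ‖w (x + y) - w x‖ₑ ^ 2 ≤ ∫⁻ s in Ioc (0 : ℝ) 1,
      ENNReal.ofReal (4 * ‖y‖) * (‖w (x + s • y)‖ₑ * ‖fderiv ℝ w (x + s • y)‖ₑ) := by
  have hline : ∀ s : ℝ, HasDerivAt (fun s : ℝ => x + s • y) y s := fun s => by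
    simpa using ((hasDerivAt_id s).smul_const y).const_add x
  have hd : ∀ s : ℝ, HasDerivAt (fun s : ℝ => w (x + s • y) * |w (x + s • y)|)
      (2 * |w (x + s • y)| * fderiv ℝ w (x + s • y) y) s := fun s => by
    have h1 : HasDerivAt (fun s : ℝ => w (x + s • y)) (fderiv ℝ w (x + s • y) y) s :=
      ((hw.differentiable one_ne_zero) _).hasFDerivAt.comp_hasDerivAt s (hline s)
    exact (hasDerivAt_mul_abs_self _).comp s h1
  have hwc := hw.continuous
  have hwf := hw.continuous_fderiv one_ne_zero
  have hc : Continuous fun s : ℝ => 2 * |w (x + s • y)| * fderiv ℝ w (x + s • y) y := by fun_prop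
  have ftc := intervalIntegral.integral_eq_sub_of_hasDerivAt (a := 0) (b := 1)
    (fun s _ => hd s) (hc.intervalIntegrable _ _)
  simp only [one_smul, zero_smul, add_zero] at ftc
  have h1 : ‖w (x + y) - w x‖ₑ ^ 2 ≤
      ‖∫ s in Ioc (0 : ℝ) 1, 2 * (2 * |w (x + s • y)| * fderiv ℝ w (x + s • y) y)‖ₑ := by
    rw [integral_const_mul, ← intervalIntegral.integral_of_le zero_le_one, ftc, ← ofReal_norm,
      ← ofReal_norm, ← ENNReal.ofReal_pow (norm_nonneg _)]
    refine ENNReal.ofReal_le_ofReal ?_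
    rw [norm_mul, Real.norm_eq_abs, Real.norm_eq_abs, sq_abs, Real.norm_eq_abs, abs_two]
    exact sub_sq_le_two_mul_abs_sub _ _
  refine h1.trans ((enorm_integral_le_lintegral_enorm _).trans (lintegral_mono fun s => ?_))
  rw [← ofReal_norm, ← ofReal_norm, ← ofReal_norm, ← ENNReal.ofReal_mul (norm_nonneg _),
    ← ENNReal.ofReal_mul (by positivity)]
  refine ENNReal.ofReal_le_ofReal ?_
  have := ContinuousLinearMap.le_opNorm (fderiv ℝ w (x + s • y)) y
  rw [norm_mul, norm_mul, norm_mul, Real.norm_eq_abs |w _|, abs_abs, Real.norm_eq_abs (w _)]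
  norm_num
  rw [Real.norm_eq_abs] at this
  nlinarith [mul_le_mul_of_nonneg_left this (abs_nonneg (w (x + s • y)))]

theorem lintegral_translate_sub_sq_le (hw : ContDiff ℝ 1 w) (y : E d) :
    ∫⁻ x, ‖w (x + y) - w x‖ₑ ^ 2 ≤
      ENNReal.ofReal (4 * ‖y‖) * ∫⁻ x, ‖w x‖ₑ * ‖fderiv ℝ w x‖ₑ := by
  have hwc := hw.continuous
  have hwf := hw.continuous_fderiv one_ne_zero
  calc ∫⁻ x, ‖w (x + y) - w x‖ₑ ^ 2
      ≤ ∫⁻ x, ∫⁻ s in Ioc (0 : ℝ) 1,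
          ENNReal.ofReal (4 * ‖y‖) * (‖w (x + s • y)‖ₑ * ‖fderiv ℝ w (x + s • y)‖ₑ) :=
        lintegral_mono fun x => enorm_translate_sub_sq_le hw x y
    _ = ∫⁻ s in Ioc (0 : ℝ) 1, ∫⁻ x,
          ENNReal.ofReal (4 * ‖y‖) * (‖w (x + s • y)‖ₑ * ‖fderiv ℝ w (x + s • y)‖ₑ) := by
        refine lintegral_lintegral_swap (Measurable.aemeasurable ?_)
        unfold Function.uncurry
        refine Measurable.const_mul (f := fun p : E d × ℝ =>
          ‖w (p.1 + p.2 • y)‖ₑ * ‖fderiv ℝ w (p.1 + p.2 • y)‖ₑ) (Measurable.fun_mul ?_ ?_) _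
        · exact (Continuous.enorm (by fun_prop)).measurable
        · exact (Continuous.enorm (by fun_prop)).measurable
    _ = ∫⁻ s in Ioc (0 : ℝ) 1, ENNReal.ofReal (4 * ‖y‖) * ∫⁻ x, ‖w x‖ₑ * ‖fderiv ℝ w x‖ₑ := by
        refine lintegral_congr fun s => ?_
        rw [lintegral_const_mul' _ _ ENNReal.ofReal_ne_top,
          lintegral_add_right_eq_self (fun x => ‖w x‖ₑ * ‖fderiv ℝ w x‖ₑ)]
    _ = _ := by simp

theorem enorm_sq_le_sub_sq_add (a b : ℝ) : ‖a‖ₑ ^ 2 ≤ ‖b - a‖ₑ ^ 2 + 2 * (‖a‖ₑ * ‖b‖ₑ) := by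
  have h2 : (2 : ENNReal) = ENNReal.ofReal 2 := by simp
  rw [h2, ← ofReal_norm, ← ofReal_norm, ← ofReal_norm, ← ENNReal.ofReal_pow (norm_nonneg _),
    ← ENNReal.ofReal_pow (norm_nonneg _), ← ENNReal.ofReal_mul (norm_nonneg _),
    ← ENNReal.ofReal_mul zero_le_two, ← ENNReal.ofReal_add (by positivity) (by positivity)]
  refine ENNReal.ofReal_le_ofReal ?_
  simp only [Real.norm_eq_abs, sq_abs]
  have := le_abs_self (a * b)
  rw [abs_mul] at this
  nlinarith [sq_nonneg b]

/-- A Nash type inequality at scale `r`. -/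
theorem volume_mul_lintegral_sq_le (hw : ContDiff ℝ 1 w) (r : ℝ) :
    volume (Metric.closedBall (0 : E d) r) * ∫⁻ x, ‖w x‖ₑ ^ 2 ≤
      volume (Metric.closedBall (0 : E d) r) *
        (ENNReal.ofReal (4 * r) * ∫⁻ x, ‖w x‖ₑ * ‖fderiv ℝ w x‖ₑ) + 2 * (∫⁻ x, ‖w x‖ₑ) ^ 2 := by
  have hwc := hw.continuous
  set B := Metric.closedBall (0 : E d) r
  set X := ∫⁻ x, ‖w x‖ₑ ^ 2
  set I := ∫⁻ x, ‖w x‖ₑ * ‖fderiv ℝ w x‖ₑ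
  set N := ∫⁻ x, ‖w x‖ₑ with hN
  -- For each shift `y`, `X` is at most a translation defect plus a correlation. Integrating over `y
  -- ∈ B` gains the volume of `B`, while the correlation integrates over all shifts to `N ^ 2`.
  have step : ∀ y ∈ B, X ≤ ENNReal.ofReal (4 * r) * I + 2 * ∫⁻ x, ‖w x‖ₑ * ‖w (x + y)‖ₑ := by
    intro y hy
    have hy' : ‖y‖ ≤ r := by simpa [B] using hy
    calc X ≤ ∫⁻ x, (‖w (x + y) - w x‖ₑ ^ 2 + 2 * (‖w x‖ₑ * ‖w (x + y)‖ₑ)) :=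
          lintegral_mono fun x => enorm_sq_le_sub_sq_add _ _
      _ = (∫⁻ x, ‖w (x + y) - w x‖ₑ ^ 2) + 2 * ∫⁻ x, ‖w x‖ₑ * ‖w (x + y)‖ₑ := by
          have hm : Measurable fun x => ‖w (x + y) - w x‖ₑ ^ 2 :=
            (Continuous.enorm (by fun_prop)).measurable.pow_const 2
          rw [lintegral_add_left hm, lintegral_const_mul' _ _ (by simp)]
      _ ≤ _ := by
          refine add_le_add ((lintegral_translate_sub_sq_le hw y).trans ?_) le_rfl
          refine mul_le_mul' (ENNReal.ofReal_le_ofReal (by linarith)) le_rfl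
  have swap : ∫⁻ y, ∫⁻ x, ‖w x‖ₑ * ‖w (x + y)‖ₑ = N ^ 2 := by
    rw [lintegral_lintegral_swap]
    · have e : ∀ x, ∫⁻ y, ‖w x‖ₑ * ‖w (x + y)‖ₑ = ‖w x‖ₑ * N := fun x => by
        rw [lintegral_const_mul' _ _ enorm_ne_top,
          lintegral_add_left_eq_self (fun y => ‖w y‖ₑ)]
      simp_rw [e]
      rw [lintegral_mul_const _ hwc.enorm.measurable, pow_two]
    · unfold Function.uncurry
      refine Measurable.aemeasurable (Measurable.fun_mul ?_ ?_)
      · exact (Continuous.enorm (by fun_prop)).measurable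
      · exact (Continuous.enorm (by fun_prop)).measurable
  calc volume B * X = ∫⁻ _ in B, X := by rw [setLIntegral_const, mul_comm]
    _ ≤ ∫⁻ y in B, (ENNReal.ofReal (4 * r) * I + 2 * ∫⁻ x, ‖w x‖ₑ * ‖w (x + y)‖ₑ) :=
        setLIntegral_mono' Metric.isClosed_closedBall.measurableSet step
    _ = volume B * (ENNReal.ofReal (4 * r) * I) + 2 * ∫⁻ y in B, ∫⁻ x, ‖w x‖ₑ * ‖w (x + y)‖ₑ := by
        rw [lintegral_add_left measurable_const, setLIntegral_const, mul_comm (volume B),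
          lintegral_const_mul' _ _ (by simp)]
    _ ≤ _ := by
        refine add_le_add le_rfl (mul_le_mul' le_rfl ?_)
        exact (setLIntegral_le_lintegral _ _).trans swap.le

/-- The dissipation controls `|w| |∇w|²`, so Young's inequality with parameter `k` trades `|w| |∇w|`
for it and `|w|`. Both `r` and `k` remain free for the final choice of scales. -/
theorem volume_real_mul_integral_sq_le (hw : ContDiff ℝ 1 w) (h1 : Integrable w) (h2 : MemLp w 2)
    {D : ℝ} (hD0 : 0 ≤ D) (hD : ∫⁻ x, ‖w x‖ₑ * ‖fderiv ℝ w x‖ₑ ^ 2 ≤ ENNReal.ofReal D)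
    {r : ℝ} (hr : 0 < r) {k : ℝ} (hk : 0 < k) :
    volume.real (Metric.closedBall (0 : E d) r) * ∫ x, w x ^ 2 ≤
      volume.real (Metric.closedBall (0 : E d) r) * (2 * r * (k * D + (∫ x, |w x|) / k)) +
        2 * (∫ x, |w x|) ^ 2 := by
  set N := ∫ x, |w x| with hN
  have hN0 : 0 ≤ N := integral_nonneg fun x => abs_nonneg _
  have eX : ∫⁻ x, ‖w x‖ₑ ^ 2 = ENNReal.ofReal (∫ x, w x ^ 2) := by
    rw [ofReal_integral_eq_lintegral_ofReal h2.integrable_sq (ae_of_all _ fun x => sq_nonneg _)]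
    refine lintegral_congr fun x => ?_
    rw [← ofReal_norm, ← ENNReal.ofReal_pow (norm_nonneg _), Real.norm_eq_abs, sq_abs]
  have eN : ∫⁻ x, ‖w x‖ₑ = ENNReal.ofReal N := by
    rw [hN, ofReal_integral_eq_lintegral_ofReal h1.abs (ae_of_all _ fun x => abs_nonneg _)]
    refine lintegral_congr fun x => ?_
    rw [← ofReal_norm, Real.norm_eq_abs]
  have eI : ∫⁻ x, ‖w x‖ₑ * ‖fderiv ℝ w x‖ₑ ≤ ENNReal.ofReal (k / 2 * D + 1 / (2 * k) * N) := by
    calc ∫⁻ x, ‖w x‖ₑ * ‖fderiv ℝ w x‖ₑ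
        ≤ ∫⁻ x, (ENNReal.ofReal (k / 2) * (‖w x‖ₑ * ‖fderiv ℝ w x‖ₑ ^ 2) +
            ENNReal.ofReal (1 / (2 * k)) * ‖w x‖ₑ) := by
          refine lintegral_mono fun x => ?_
          rw [← ofReal_norm, ← ofReal_norm, ← ENNReal.ofReal_pow (norm_nonneg _),
            ← ENNReal.ofReal_mul (norm_nonneg _), ← ENNReal.ofReal_mul (norm_nonneg _),
            ← ENNReal.ofReal_mul (by positivity), ← ENNReal.ofReal_mul (by positivity),
            ← ENNReal.ofReal_add (by positivity) (by positivity)]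
          refine ENNReal.ofReal_le_ofReal ?_
          have e : k / 2 * (‖w x‖ * ‖fderiv ℝ w x‖ ^ 2) + 1 / (2 * k) * ‖w x‖ -
              ‖w x‖ * ‖fderiv ℝ w x‖ = ‖w x‖ * (k * ‖fderiv ℝ w x‖ - 1) ^ 2 / (2 * k) := by
            field_simp
            ring
          have : 0 ≤ ‖w x‖ * (k * ‖fderiv ℝ w x‖ - 1) ^ 2 / (2 * k) := by positivity
          linarith
      _ = ENNReal.ofReal (k / 2) * (∫⁻ x, ‖w x‖ₑ * ‖fderiv ℝ w x‖ₑ ^ 2) +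
            ENNReal.ofReal (1 / (2 * k)) * ∫⁻ x, ‖w x‖ₑ := by
          rw [lintegral_add_right _ (hw.continuous.enorm.measurable.const_mul _),
            lintegral_const_mul' _ _ ENNReal.ofReal_ne_top,
            lintegral_const_mul' _ _ ENNReal.ofReal_ne_top]
      _ ≤ ENNReal.ofReal (k / 2) * ENNReal.ofReal D + ENNReal.ofReal (1 / (2 * k)) * ∫⁻ x, ‖w x‖ₑ :=
          add_le_add (mul_le_mul' le_rfl hD) le_rfl
      _ = _ := by
          rw [eN, ← ENNReal.ofReal_mul (by positivity), ← ENNReal.ofReal_mul (by positivity),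
            ← ENNReal.ofReal_add (by positivity) (by positivity)]
  have key := volume_mul_lintegral_sq_le hw r
  have hX0 : 0 ≤ ∫ x, w x ^ 2 := integral_nonneg fun x => sq_nonneg _
  have hv : volume (Metric.closedBall (0 : E d) r) =
      ENNReal.ofReal (volume.real (Metric.closedBall (0 : E d) r)) :=
    (ofReal_measureReal (measure_closedBall_lt_top.ne)).symm
  have h2' : 2 * ENNReal.ofReal N ^ 2 = ENNReal.ofReal (2 * N ^ 2) := by
    rw [ENNReal.ofReal_mul zero_le_two, ENNReal.ofReal_pow hN0]
    simp
  have hv0 : 0 ≤ volume.real (Metric.closedBall (0 : E d) r) := measureReal_nonneg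
  have key2 := key.trans (add_le_add (mul_le_mul' le_rfl (mul_le_mul' le_rfl eI)) le_rfl)
  rw [eX, eN, hv, h2', ← ENNReal.ofReal_mul hv0, ← ENNReal.ofReal_mul (by positivity),
    ← ENNReal.ofReal_mul hv0,
    ← ENNReal.ofReal_add (by positivity) (by positivity),
    ENNReal.ofReal_le_ofReal_iff (by positivity)] at key2
  have e : 4 * r * (k / 2 * D + 1 / (2 * k) * N) = 2 * r * (k * D + N / k) := by
    field_simp
    ring
  rwa [e] at key2

end Nash

/-! ### Consequences of the conditions on the balls: volume bound and global comparison. -/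

/-- For `l > 0`, the left side is the tangent line of `y ↦ y⁻²` at `y = 1 / l`. -/
theorem three_mul_sq_sub_le_inv_sq {y l : ℝ} (hy : 0 < y) (hl : 0 ≤ l) :
    3 * l ^ 2 - 2 * l ^ 3 * y ≤ (y ^ 2)⁻¹ := by
  rw [← one_div, le_div_iff₀ (by positivity)]
  nlinarith [mul_nonneg (sq_nonneg (1 - l * y)) (by positivity : 0 ≤ 1 + 2 * (l * y))]

theorem IsProbDensity.setIntegral_le_one {d : ℕ} {p : E d → ℝ} (hp : IsProbDensity p)
    (S : Set (E d)) : ∫ x in S, p x ≤ 1 := by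
  rw [← hp.integral_eq_one]
  exact setIntegral_le_integral hp.integrable (ae_of_all _ hp.nonneg)

/-- The mean of `f⁻²` over a ball is at least the square of the volume of the ball. -/
theorem volume_le_sqrt_mean_inv_sq {d : ℕ} {f : E d → ℝ} (hf : IsProbDensity f)
    (hpos : ∀ x, 0 < f x) (hc : Continuous f) {B : Set (E d)} (hB : IsBall B) :
    volume.real B ≤ √((volume.real B)⁻¹ * ∫ x in B, (f x ^ 2)⁻¹) := by
  obtain ⟨z, r, hr, rfl⟩ := hB
  set B := Metric.closedBall z r
  set v := volume.real B with hv
  have hfin : volume B ≠ ⊤ := measure_closedBall_lt_top.ne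
  have hv0 : 0 < v := ENNReal.toReal_pos (Metric.measure_closedBall_pos volume z hr).ne' hfin
  have hinv : IntegrableOn (fun x => (f x ^ 2)⁻¹) B :=
    ((hc.pow 2).inv₀ fun x => (pow_pos (hpos x) 2).ne').continuousOn.integrableOn_compact
      (isCompact_closedBall z r)
  have hconst : IntegrableOn (fun _ : E d => 3 * v ^ 2) B := integrableOn_const hfin
  have hlin : IntegrableOn (fun x => 2 * v ^ 3 * f x) B := (hf.integrable.integrableOn).const_mul _
  -- The tangent point `1 / v` is the largest possible mean of `f` over `B`; the left side is then
  -- at least `3 v³ - 2 v³ = v³`.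
  have h1 : ∫ x in B, (3 * v ^ 2 - 2 * v ^ 3 * f x) ≤ ∫ x in B, (f x ^ 2)⁻¹ :=
    integral_mono (hconst.sub hlin) hinv fun x => three_mul_sq_sub_le_inv_sq (hpos x) hv0.le
  rw [integral_sub hconst hlin, setIntegral_const, integral_const_mul, smul_eq_mul, ← hv] at h1
  have h2 := hf.setIntegral_le_one B
  have h3 : v ^ 3 ≤ ∫ x in B, (f x ^ 2)⁻¹ := by
    nlinarith [mul_le_mul_of_nonneg_left h2 (by positivity : 0 ≤ 2 * v ^ 3)]
  refine Real.le_sqrt_of_sq_le ?_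
  calc v ^ 2 = v⁻¹ * v ^ 3 := by field_simp
    _ ≤ _ := mul_le_mul_of_nonneg_left h3 (inv_nonneg.2 hv0.le)

section CoversModes

variable {d K : ℕ} {f : E d → ℝ} {ε₀ c M₁ M₂ : ℝ} {Q : ℝ → Fin K → Set (E d)}

/-- The volume of the balls covering the modes grows at most like a small power of `1 / ε`. -/
theorem CoversModes.exists_volume_le (hQ : CoversModes f ε₀ c M₁ M₂ Q) (hd : 0 < d) (hc0 : 0 < c)
    (hε₀ : ε₀ < 1) (hM₁ : 0 < M₁) (hf : IsProbDensity f) (hpos : ∀ x, 0 < f x)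
    (hc : Continuous f) :
    ∃ B : ℝ, 0 < B ∧ ∀ ε ∈ Ioc 0 ε₀, ∀ i,
      volume.real (Q ε i) ≤ B * ε ^ (-(d / (2 * (d + 4))) : ℝ) := by
  have hd' : (0 : ℝ) < d := by exact_mod_cast hd
  -- The power of `1/ε` spent on the logarithm: `1/4 + κ = (d + 2) / (2 (d + 4))`, and raising to
  -- the power `d / (d + 2)` gives the claimed exponent.
  set κ : ℝ := d / (4 * (d + 4)) with hκ
  have hκ0 : 0 < κ := by positivity
  set s : ℝ := κ / c with hs
  have hs0 : 0 < s := by positivity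
  set A : ℝ := M₁ * (s⁻¹) ^ c with hA
  have hA0 : 0 < A := by positivity
  refine ⟨A ^ ((d : ℝ) / (d + 2)), by positivity, fun ε hε i => ?_⟩
  have hε0 : 0 < ε := hε.1
  set v := volume.real (Q ε i) with hv
  have hv0 : 0 ≤ v := measureReal_nonneg
  have h1 := hQ.sup_le ε hε i (Q ε i) (hQ.isBall ε hε i) subset_rfl
  have h2 := volume_le_sqrt_mean_inv_sq hf hpos hc (hQ.isBall ε hε i)
  have h3 : v ^ (2 / d : ℝ) * v ≤ M₁ * ε ^ (-(1 / 4) : ℝ) * Real.log (1 / ε) ^ c :=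
    (mul_le_mul_of_nonneg_left h2 (by positivity)).trans h1
  have hlog0 : 0 ≤ Real.log (1 / ε) :=
    Real.log_nonneg (one_le_one_div hε0 (hε.2.trans hε₀.le))
  have hlog : Real.log (1 / ε) ^ c ≤ (s⁻¹) ^ c * ε ^ (-κ) := by
    have e1 : Real.log (1 / ε) ≤ s⁻¹ * ε ^ (-s) := by
      have := Real.log_le_rpow_div (one_div_pos.2 hε0).le hs0
      rwa [one_div, Real.inv_rpow hε0.le, ← Real.rpow_neg hε0.le, div_eq_inv_mul, ← one_div ε] at this
    refine (Real.rpow_le_rpow hlog0 e1 hc0.le).trans_eq ?_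
    rw [Real.mul_rpow (by positivity) (by positivity), ← Real.rpow_mul hε0.le]
    congr 2
    rw [hs]
    field_simp
  have h4 : v ^ (2 / d : ℝ) * v ≤ A * ε ^ (-(1 / 4) - κ : ℝ) := by
    refine h3.trans ((mul_le_mul_of_nonneg_left hlog (by positivity)).trans_eq ?_)
    rw [sub_eq_add_neg, Real.rpow_add hε0, hA]
    ring
  rcases hv0.eq_or_lt with hz | hvp
  · rw [← hz]; positivity
  have h5 : v ^ (2 / d : ℝ) * v = v ^ ((d + 2) / d : ℝ) := by
    rw [← Real.rpow_add_one hvp.ne']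
    congr 1
    field_simp
    ring
  rw [h5] at h4
  have h6 := Real.rpow_le_rpow (by positivity) h4 (by positivity : (0 : ℝ) ≤ (d : ℝ) / (d + 2))
  rw [← Real.rpow_mul hv0, Real.mul_rpow hA0.le (by positivity), ← Real.rpow_mul hε0.le] at h6
  have e1 : ((d : ℝ) + 2) / d * (d / (d + 2)) = 1 := by field_simp
  have e2 : (-(1 / 4) - κ) * ((d : ℝ) / (d + 2)) = -(d / (2 * (d + 4))) := by
    rw [hκ]
    field_simp
    ring
  rwa [e1, e2, Real.rpow_one] at h6

theorem CoversModes.measurableSet_iUnion (hQ : CoversModes f ε₀ c M₁ M₂ Q) {ε : ℝ}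
    (hε : ε ∈ Ioc 0 ε₀) : MeasurableSet (⋃ i, Q ε i) := by
  refine MeasurableSet.iUnion fun i => ?_
  obtain ⟨x, r, -, h⟩ := hQ.isBall ε hε i
  rw [h]
  exact Metric.isClosed_closedBall.measurableSet

theorem CoversModes.volume_ne_top (hQ : CoversModes f ε₀ c M₁ M₂ Q) {ε : ℝ}
    (hε : ε ∈ Ioc 0 ε₀) (i : Fin K) : volume (Q ε i) ≠ ⊤ := by
  obtain ⟨x, r, -, h⟩ := hQ.isBall ε hε i
  rw [h]
  exact measure_closedBall_lt_top.ne

/-- The sets `⋃ i, Q ε i` are dense as `ε` varies, so the lower bound holds everywhere. -/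
theorem CoversModes.mul_le_of_forall_mem (hQ : CoversModes f ε₀ c M₁ M₂ Q) (hε₀ : 0 < ε₀)
    (hf : IsProbDensity f) (hpos : ∀ x, 0 < f x) (hc : Continuous f) {p : E d → ℝ}
    (hp : Continuous p) {α : ℝ}
    (hα : ∀ ε ∈ Ioc 0 ε₀, ∀ x ∈ ⋃ i, Q ε i, α * f x ≤ p x) (x : E d) : α * f x ≤ p x := by
  by_contra hx
  set U := {y | p y < α * f y} with hU
  have hUo : IsOpen U := isOpen_lt hp (continuous_const.mul hc)
  have hUne : U.Nonempty := ⟨x, not_le.1 hx⟩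
  have hm : 0 < ∫ y in U, f y := by
    rw [setIntegral_pos_iff_support_of_nonneg_ae (ae_of_all _ hf.nonneg) hf.integrable.integrableOn]
    have : Function.support f = univ := eq_univ_of_forall fun y => (hpos y).ne'
    rw [this, univ_inter]
    exact hUo.measure_pos volume hUne
  set m := ∫ y in U, f y
  -- Failure at one point gives failure on an open set of positive `f`-mass `m`; with `ε^(1/4) ≤ m /
  -- 2`, the balls carry too much mass to avoid that set.
  set ε := min ε₀ ((m / 2) ^ 4) with hε
  have hεm : ε ∈ Ioc 0 ε₀ := ⟨by positivity, min_le_left _ _⟩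
  have hε4 : ε ^ (1 / 4 : ℝ) ≤ m / 2 := by
    refine (Real.rpow_le_rpow hεm.1.le (min_le_right _ _) (by norm_num)).trans_eq ?_
    rw [← Real.rpow_natCast, ← Real.rpow_mul (by positivity)]
    norm_num
  have hsub : (⋃ i, Q ε i) ⊆ Uᶜ := fun y hy hyU => not_lt.2 (hα ε hεm y hy) hyU
  have h1 := hQ.mass_ge ε hεm
  have h2 : ∫ y in ⋃ i, Q ε i, f y ≤ ∫ y in Uᶜ, f y :=
    setIntegral_mono_set hf.integrable.integrableOn (ae_of_all _ hf.nonneg) hsub.eventuallyLE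
  have h3 := integral_add_compl hUo.measurableSet hf.integrable
  rw [hf.integral_eq_one] at h3
  linarith

end CoversModes

/-! ### The `L¹` bound and the choice of scales. -/

/-- Cauchy-Schwarz, from the discriminant of a quadratic in `a` bounding `∫ (|w| - a)²` over `S`
from above. -/
theorem sq_setIntegral_abs_le {d : ℕ} {w : E d → ℝ} (h1 : Integrable w) (h2 : MemLp w 2)
    {S : Set (E d)} (hS : volume S ≠ ⊤) :
    (∫ x in S, |w x|) ^ 2 ≤ volume.real S * ∫ x, w x ^ 2 := by
  set Y := ∫ x in S, |w x|
  set V := volume.real S with hV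
  set X := ∫ x, w x ^ 2
  have hV0 : 0 ≤ V := measureReal_nonneg
  have key : ∀ a : ℝ, 0 ≤ V * (a * a) + (-2 * Y) * a + X := by
    intro a
    have i0 : IntegrableOn (fun x => w x ^ 2) S := h2.integrable_sq.integrableOn
    have i1 : IntegrableOn (fun x => 2 * a * |w x|) S := h1.abs.integrableOn.const_mul _
    have i2 : IntegrableOn (fun _ : E d => a ^ 2) S := integrableOn_const hS
    have i3 : IntegrableOn (fun x => w x ^ 2 - 2 * a * |w x|) S := i0.sub i1
    have e : ∫ x in S, (|w x| - a) ^ 2 = (∫ x in S, w x ^ 2) - 2 * a * Y + V * a ^ 2 := by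
      calc ∫ x in S, (|w x| - a) ^ 2 = ∫ x in S, (w x ^ 2 - 2 * a * |w x| + a ^ 2) := by
            congr 1
            funext x
            rw [sub_sq, sq_abs]
            ring
        _ = _ := by
            rw [integral_add i3 i2, integral_sub i0 i1, integral_const_mul,
              setIntegral_const, smul_eq_mul]
    have h3 : 0 ≤ ∫ x in S, (|w x| - a) ^ 2 := integral_nonneg fun x => sq_nonneg _
    have h4 : ∫ x in S, w x ^ 2 ≤ X :=
      setIntegral_le_integral h2.integrable_sq (ae_of_all _ fun x => sq_nonneg _)
    nlinarith
  have := discrim_le_zero key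
  rw [discrim] at this
  linarith

/-- The `L¹` distance of two densities is controlled by the mass of `f` outside a set and the `L²`
distance. -/
theorem sq_integral_abs_sub_le {d : ℕ} {f p : E d → ℝ} (hf : IsProbDensity f)
    (hp : IsProbDensity p) (h2 : MemLp (fun x => p x - f x) 2) {S : Set (E d)}
    (hSm : MeasurableSet S) (hS : volume S ≠ ⊤) {η : ℝ} (hη : 1 - η ≤ ∫ x in S, f x) :
    (∫ x, |p x - f x|) ^ 2 ≤ 8 * η ^ 2 + 8 * (volume.real S * ∫ x, (p x - f x) ^ 2) := by
  have hi : Integrable fun x => p x - f x := hp.integrable.sub hf.integrable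
  have h0 : ∫ x, (p x - f x) = 0 := by
    rw [integral_sub hp.integrable hf.integrable, hp.integral_eq_one, hf.integral_eq_one, sub_self]
  have hn : Integrable fun x => max (-(p x - f x)) 0 := hi.neg.pos_part
  -- Equal masses reduce everything to the negative part of `p - f`, which is at most `f`. Thus no
  -- bound on `p` outside `S` is needed.
  have e1 : ∫ x, |p x - f x| = 2 * ∫ x, max (-(p x - f x)) 0 := by
    have : ∀ x, |p x - f x| = (p x - f x) + 2 * max (-(p x - f x)) 0 := by
      intro x
      rcases le_total 0 (p x - f x) with h | h
      · rw [abs_of_nonneg h, max_eq_right (by linarith)]; ring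
      · rw [abs_of_nonpos h, max_eq_left (by linarith)]; ring
    simp_rw [this]
    rw [integral_add hi (hn.const_mul 2), h0, integral_const_mul, zero_add]
  have e2 := integral_add_compl hSm hn
  have e3 := integral_add_compl hSm hf.integrable
  rw [hf.integral_eq_one] at e3
  have b1 : ∫ x in S, max (-(p x - f x)) 0 ≤ ∫ x in S, |p x - f x| :=
    integral_mono hn.integrableOn hi.abs.integrableOn fun x =>
      max_le (neg_le_abs _) (abs_nonneg _)
  have b2 : ∫ x in Sᶜ, max (-(p x - f x)) 0 ≤ ∫ x in Sᶜ, f x :=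
    integral_mono hn.integrableOn hf.integrable.integrableOn fun x =>
      max_le (by linarith [hp.nonneg x]) (hf.nonneg x)
  have b3 := sq_setIntegral_abs_le hi h2 hS
  have b4 : 0 ≤ ∫ x, |p x - f x| := integral_nonneg fun x => abs_nonneg _
  set Y := ∫ x in S, |p x - f x|
  have b5 : ∫ x, |p x - f x| ≤ 2 * (Y + η) := by linarith
  have b6 : (∫ x, |p x - f x|) ^ 2 ≤ (2 * (Y + η)) ^ 2 := pow_le_pow_left₀ b4 b5 2
  nlinarith [sq_nonneg (Y - η)]

/-- The choice of scales in the Nash type inequality. -/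
theorem exists_const_of_nash {d : ℕ} (hd : 0 < d) {ν β B : ℝ} (hν : 0 < ν) (hβ : 0 < β)
    (hB : 1 ≤ B) : ∃ C : ℝ, 0 < C ∧ ∀ q X N : ℝ, 0 < q → q ≤ 1 → 0 ≤ X → 0 ≤ N →
      N ^ 2 ≤ 8 * q ^ (2 * d + 8) + 8 * (B * (q ^ (2 * d))⁻¹ * X) →
      (∀ r k : ℝ, 0 < r → 0 < k → ν * r ^ d * X ≤
        ν * r ^ d * (2 * r * (k * (q ^ (4 * d + 16) / β) + N / k)) + 2 * N ^ 2) →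
      X ≤ C * q ^ (2 * d + 8) := by
  -- Large enough that the part of `2 N ^ 2` proportional to `X` is absorbed by half of the left
  -- side.
  set R : ℝ := max 1 (32 * B / ν) with hR
  have hR1 : 1 ≤ R := le_max_left _ _
  have hR0 : 0 < R := by linarith
  set W := ν * R ^ d with hW
  have hWB : 32 * B ≤ W := by
    calc 32 * B = ν * (32 * B / ν) := by field_simp
      _ ≤ ν * R := by gcongr; exact le_max_right _ _
      _ ≤ W := by
        rw [hW]
        gcongr
        exact le_self_pow₀ hR1 hd.ne'
  have hW0 : 0 < W := by positivity
  set b := 2 * R * √(8 * B) with hb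
  have hb0 : 0 ≤ b := by positivity
  set a := 4 * R / β + 1 with ha
  have ha0 : 0 < a := by positivity
  refine ⟨2 * (1 + a + b ^ 2) + 2 * b ^ 2, by positivity, ?_⟩
  intro q X N hq hq1 hX hN hNX hnash
  set P := q ^ (2 * d + 8) with hP
  have hP0 : 0 < P := by positivity
  -- In units of `P = q^(2d+8)` the estimate becomes `T ≤ a + 2 b √(1 + T)`, whose right side grows
  -- sublinearly, so `T` is bounded.
  set T := X / P with hT
  have hT0 : 0 ≤ T := by positivity
  have hXT : X = T * P := by rw [hT]; field_simp
  set S := √(1 + T) with hS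
  have hS0 : 0 ≤ S := Real.sqrt_nonneg _
  have hS2 : S ^ 2 = 1 + T := Real.sq_sqrt (by positivity)
  have hN1 : N ≤ √(8 * B) * S * q ^ 4 := by
    refine le_of_sq_le_sq ?_ (by positivity)
    rw [mul_pow, mul_pow, Real.sq_sqrt (by positivity), hS2]
    refine hNX.trans ?_
    have e1 : B * (q ^ (2 * d))⁻¹ * X = B * T * q ^ 8 := by
      rw [hXT, hP, pow_add]
      field_simp
    have e2 : q ^ (2 * d + 8) ≤ q ^ 8 := pow_le_pow_of_le_one hq.le hq1 (by omega)
    rw [e1]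
    nlinarith [mul_le_mul_of_nonneg_right hB (by positivity : 0 ≤ q ^ 8)]
  -- With `r ~ q⁻²`, `r ^ d` matches the volume factor `q^(-2d)`. This `k` gives the dissipation
  -- term order `q^(2d+8)`, and the `N` term order `q^(2d+4) N`, comparable to `P √(1 + T)` by
  -- `hN1`.
  have h1 := hnash (R * (q ^ 2)⁻¹) (q ^ (2 * d + 6))⁻¹ (by positivity) (by positivity)
  have e1 : ν * (R * (q ^ 2)⁻¹) ^ d = W * (q ^ (2 * d))⁻¹ := by
    rw [hW, mul_pow, inv_pow, ← pow_mul, mul_assoc]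
  have e2 : 2 * (R * (q ^ 2)⁻¹) * ((q ^ (2 * d + 6))⁻¹ * (q ^ (4 * d + 16) / β) +
      N / (q ^ (2 * d + 6))⁻¹) = 2 * R / β * P + 2 * R * q ^ (2 * d + 4) * N := by
    rw [hP]
    field_simp
    ring
  rw [e1, e2] at h1
  have h2 : W * X ≤ W * (2 * R / β * P + 2 * R * q ^ (2 * d + 4) * N) + 2 * N ^ 2 * q ^ (2 * d) := by
    have hp : 0 < q ^ (2 * d) := by positivity
    have := mul_le_mul_of_nonneg_right h1 hp.le
    calc W * X = W * (q ^ (2 * d))⁻¹ * X * q ^ (2 * d) := by field_simp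
      _ ≤ _ := this
      _ = _ := by field_simp
  have h3 : 2 * N ^ 2 * q ^ (2 * d) ≤ 16 * P + 16 * B * X := by
    have hp : 0 < q ^ (2 * d) := by positivity
    have := mul_le_mul_of_nonneg_right hNX hp.le
    have e : (8 * P + 8 * (B * (q ^ (2 * d))⁻¹ * X)) * q ^ (2 * d) =
        8 * P * q ^ (2 * d) + 8 * B * X := by field_simp
    rw [e] at this
    have hp1 : q ^ (2 * d) ≤ 1 := pow_le_one₀ hq.le hq1
    nlinarith [mul_le_mul_of_nonneg_left hp1 hP0.le]
  have h4 : q ^ (2 * d + 4) * N ≤ √(8 * B) * S * P := by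
    calc q ^ (2 * d + 4) * N ≤ q ^ (2 * d + 4) * (√(8 * B) * S * q ^ 4) := by gcongr
      _ = √(8 * B) * S * P := by rw [hP]; ring
  have h5 : 2 * R * q ^ (2 * d + 4) * N ≤ b * S * P := by
    have := mul_le_mul_of_nonneg_left h4 (by positivity : 0 ≤ 2 * R)
    rw [hb]
    linarith
  have h6 : W * X ≤ W * (2 * R / β * P + b * S * P) + W / 2 * P + W / 2 * X := by
    have m1 := mul_le_mul_of_nonneg_left (add_le_add_right h5 (2 * R / β * P)) hW0.le
    have m2 : 16 * B * X ≤ W / 2 * X := mul_le_mul_of_nonneg_right (by linarith) hX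
    have m3 : 16 * P ≤ W / 2 * P := mul_le_mul_of_nonneg_right (by linarith) hP0.le
    linarith
  have h7 : X ≤ a * P + 2 * b * S * P := by
    refine le_of_mul_le_mul_left ?_ (by positivity : 0 < W / 2)
    have : W / 2 * (a * P + 2 * b * S * P) = W * (2 * R / β * P + b * S * P) + W / 2 * P := by
      rw [ha]; ring
    linarith
  have h8 : T ≤ a + 2 * b * S := by
    rw [hT, div_le_iff₀ hP0]
    linarith
  rw [hXT]
  refine mul_le_mul_of_nonneg_right ?_ hP0.le
  nlinarith [sq_nonneg (S - 2 * b)]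

/-! ### The main theorem. -/

theorem theorem3 (d : ℕ) (hd : 0 < d) (α M₁ : ℝ) (hα : 0 < α) (hM₁ : 0 < M₁) :
    -- how large `M₂` has to be depends on `d`, `α` and `M₁` only
    ∃ M₂min : ℝ, 0 < M₂min ∧ ∀ M₂ : ℝ, M₂min ≤ M₂ →
    ∀ (K : ℕ) (ε₀ c : ℝ), 0 < ε₀ → ε₀ < 1 → 0 < c →
    ∀ (f : E d → ℝ) (g : ℝ → E d → ℝ) (Q : ℝ → Fin K → Set (E d)),
    -- the target: a positive, continuously differentiable probability density in `L²`
    IsProbDensity f → (∀ x, 0 < f x) → ContDiff ℝ 1 f → MemLp f 2 →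
    -- the gradient flow, positive, in `L²`, with space derivative continuous in `(t, x)`
    IsWassersteinGradientFlow (sqL2Dist f) g →
    (∀ t, 0 < t → (∀ x, 0 < g t x) ∧ Differentiable ℝ (g t) ∧ MemLp (g t) 2) →
    ContinuousOn (fun p : ℝ × E d => g p.1 p.2) (Ioi 0 ×ˢ univ) →
    ContinuousOn (fun p : ℝ × E d => gradient (g p.1) p.2) (Ioi 0 ×ˢ univ) →
    -- the two assumptions on the balls
    CoversModes f ε₀ c M₁ M₂ Q →
    (∀ ε ∈ Ioc 0 ε₀, ∀ t, 0 < t → ∀ x ∈ ⋃ i, Q ε i, α * f x ≤ g t x) →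
    ∃ C : ℝ, 0 < C ∧ ∀ t : ℝ, 0 < t → ∀ ℓ : ℝ, HasDerivAt (fun s => sqL2Dist f (g s)) ℓ t →
      0 < |ℓ| → |ℓ| ≤ ε₀ →
        C * (⨆ i : Fin K, (∫ x in Q |ℓ| i, (g t x - f x) ^ 2) ^ 2 *
            min (volume.real (Q |ℓ| i)) (volume.real (Q |ℓ| i))⁻¹) ≤ |ℓ| := by
  -- the global energy dissipation and a Nash type inequality suffice: `M₂` is not constrained
  refine ⟨1, one_pos, ?_⟩
  intro M₂ _ K ε₀ c hε₀ hε₀1 hc0 f g Q hf hfpos hfd hf2 hg hg1 hgc hgg hQ hlow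
  have hflow := isRegularFlow_of_isWassersteinGradientFlow hf hfd hf2 hg hg1 hgc hgg
  obtain ⟨B₀, hB₀, hvol⟩ := hQ.exists_volume_le hd hc0 hε₀1 hM₁ hf hfpos hfd.continuous
  -- Chosen so that `|g - f| ≤ g / β`: where `g ≥ f` the difference is at most `g`, elsewhere at
  -- most `f ≤ g / α`.
  set β := min 1 α with hβ
  have hβ0 : 0 < β := by positivity
  set ν := volume.real (Metric.ball (0 : E d) 1) with hν
  have hν0 : 0 < ν :=
    ENNReal.toReal_pos (Metric.measure_ball_pos volume _ one_pos).ne' measure_ball_lt_top.ne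
  obtain ⟨C, hC, hCbound⟩ := exists_const_of_nash hd hν0 hβ0
    (le_max_left 1 (K * B₀))
  refine ⟨(C ^ 2)⁻¹, by positivity, ?_⟩
  intro t ht ℓ hℓ hℓ0 hℓ1
  set ε := |ℓ| with hε
  have hεm : ε ∈ Ioc 0 ε₀ := ⟨hℓ0, hℓ1⟩
  set w : E d → ℝ := fun x => g t x - f x with hw
  have hw1 : ContDiff ℝ 1 w := hflow.contDiff_diff ht
  have hwi : Integrable w := (hg.density t ht).integrable.sub hf.integrable
  have hw2 : MemLp w 2 := hflow.memLp_diff ht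
  have hglob : ∀ x, α * f x ≤ g t x :=
    hQ.mul_le_of_forall_mem hε₀ hf hfpos hfd.continuous (hflow.continuous_density ht)
      fun ε hε x hx => hlow ε hε t ht x hx
  have hβw : ∀ x, |w x| ≤ g t x / β := by
    intro x
    have h1 := hglob x
    have h2 := hfpos x
    have h3 := (hg1 t ht).1 x
    have h4 : β ≤ 1 := min_le_left _ _
    have h5 : β * f x ≤ α * f x := mul_le_mul_of_nonneg_right (min_le_right _ _) h2.le
    have h6 : g t x ≤ g t x / β := by rw [le_div_iff₀ hβ0]; nlinarith
    have h7 : f x ≤ g t x / β := by rw [le_div_iff₀ hβ0]; nlinarith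
    exact abs_le.2 ⟨by simp only [hw]; linarith, by simp only [hw]; linarith⟩
  have hD : ∫⁻ x, ‖w x‖ₑ * ‖fderiv ℝ w x‖ₑ ^ 2 ≤ ENNReal.ofReal (ε / β) := by
    have hdiss := hflow.lintegral_dissipation_le ht hℓ
    calc ∫⁻ x, ‖w x‖ₑ * ‖fderiv ℝ w x‖ₑ ^ 2
        ≤ ∫⁻ x, ENNReal.ofReal β⁻¹ *
            (‖gradient (g t) x - gradient f x‖ₑ ^ 2 * ENNReal.ofReal (g t x)) := by
          refine lintegral_mono fun x => ?_
          have e : ‖fderiv ℝ w x‖ₑ = ‖gradient (g t) x - gradient f x‖ₑ := by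
            rw [(hflow.hasGradientAt t ht x).hasFDerivAt.fderiv, ← ofReal_norm, ← ofReal_norm,
              LinearIsometryEquiv.norm_map]
          have e' : ‖w x‖ₑ ≤ ENNReal.ofReal β⁻¹ * ENNReal.ofReal (g t x) := by
            rw [← ofReal_norm, ← ENNReal.ofReal_mul (by positivity), Real.norm_eq_abs]
            refine ENNReal.ofReal_le_ofReal ?_
            rw [← div_eq_inv_mul]
            exact hβw x
          rw [e]
          refine (mul_le_mul' e' le_rfl).trans_eq ?_
          ring
      _ = ENNReal.ofReal β⁻¹ *
            ∫⁻ x, ‖gradient (g t) x - gradient f x‖ₑ ^ 2 * ENNReal.ofReal (g t x) :=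
          lintegral_const_mul' _ _ ENNReal.ofReal_ne_top
      _ ≤ ENNReal.ofReal β⁻¹ * ENNReal.ofReal ε := mul_le_mul' le_rfl hdiss
      _ = ENNReal.ofReal (ε / β) := by
          rw [← ENNReal.ofReal_mul (by positivity), div_eq_inv_mul]
  set X := ∫ x, w x ^ 2 with hX
  set N := ∫ x, |w x| with hN
  have hX0 : 0 ≤ X := integral_nonneg fun x => sq_nonneg _
  -- This root makes every exponent an integer: `ε = q^(4d+16)`, `ε^(1/4) = q^(d+4)`, and the volume
  -- bound is a multiple of `q^(-2d)`.
  set q := ε ^ (1 / (4 * (d + 4)) : ℝ) with hq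
  have hd' : (0 : ℝ) < d := by exact_mod_cast hd
  have hq0 : 0 < q := by positivity
  have hq1 : q ≤ 1 := Real.rpow_le_one hℓ0.le (hℓ1.trans hε₀1.le) (by positivity)
  have hqpow : ∀ n : ℕ, q ^ n = ε ^ ((n : ℝ) / (4 * (d + 4))) := fun n => by
    rw [hq, ← Real.rpow_natCast, ← Real.rpow_mul hℓ0.le]
    congr 1
    ring
  have hq4 : q ^ (4 * d + 16) = ε := by
    rw [hqpow]
    have : ((4 * d + 16 : ℕ) : ℝ) / (4 * (d + 4)) = 1 := by push_cast; field_simp; ring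
    rw [this, Real.rpow_one]
  have hqd : ε ^ (1 / 4 : ℝ) = q ^ (d + 4) := by
    rw [hqpow]
    congr 1
    push_cast
    field_simp
  have hqv : ε ^ (-(d / (2 * (d + 4))) : ℝ) = (q ^ (2 * d))⁻¹ := by
    rw [hqpow, Real.rpow_neg hℓ0.le]
    congr 2
    push_cast
    field_simp
    ring
  have hVfin : volume (⋃ i, Q ε i) ≠ ⊤ :=
    ((measure_iUnion_le _).trans_lt
      (by rw [tsum_fintype]; exact ENNReal.sum_lt_top.2 fun i _ => (hQ.volume_ne_top hεm i).lt_top)).ne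
  have hV : volume.real (⋃ i, Q ε i) ≤ max 1 (K * B₀) * (q ^ (2 * d))⁻¹ := by
    calc volume.real (⋃ i, Q ε i) ≤ ∑ i, volume.real (Q ε i) := measureReal_iUnion_fintype_le _
      _ ≤ ∑ _i : Fin K, B₀ * (q ^ (2 * d))⁻¹ := by
          refine Finset.sum_le_sum fun i _ => ?_
          rw [← hqv]
          exact hvol ε hεm i
      _ = K * B₀ * (q ^ (2 * d))⁻¹ := by simp [mul_assoc]
      _ ≤ _ := by gcongr; exact le_max_right _ _
  have hN2 : N ^ 2 ≤ 8 * q ^ (2 * d + 8) + 8 * (max 1 (K * B₀) * (q ^ (2 * d))⁻¹ * X) := by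
    refine (sq_integral_abs_sub_le hf (hg.density t ht) hw2 (hQ.measurableSet_iUnion hεm) hVfin
      (hQ.mass_ge ε hεm)).trans ?_
    have : (ε ^ (1 / 4 : ℝ)) ^ 2 = q ^ (2 * d + 8) := by rw [hqd, ← pow_mul]; ring_nf
    rw [this]
    gcongr
  have hXC : X ≤ C * q ^ (2 * d + 8) := by
    refine hCbound q X N hq0 hq1 hX0 (integral_nonneg fun x => abs_nonneg _) hN2 ?_
    intro r k hr hk
    have := volume_real_mul_integral_sq_le hw1 hwi hw2 (by positivity) hD hr hk
    rwa [Measure.addHaar_real_closedBall _ _ hr.le, finrank_euclideanSpace_fin, mul_comm (r ^ d),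
      ← hq4] at this
  have hX2 : X ^ 2 ≤ C ^ 2 * ε := by
    calc X ^ 2 ≤ (C * q ^ (2 * d + 8)) ^ 2 := pow_le_pow_left₀ hX0 hXC 2
      _ = C ^ 2 * q ^ (4 * d + 16) := by ring
      _ = C ^ 2 * ε := by rw [hq4]
  rw [inv_mul_le_iff₀ (by positivity)]
  refine Real.iSup_le (fun i => ?_) (by positivity)
  have h1 : ∫ x in Q ε i, (g t x - f x) ^ 2 ≤ X :=
    setIntegral_le_integral hw2.integrable_sq (ae_of_all _ fun x => sq_nonneg _)
  have h0 : 0 ≤ ∫ x in Q ε i, (g t x - f x) ^ 2 := integral_nonneg fun x => sq_nonneg _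
  have hv0 : 0 ≤ volume.real (Q ε i) := measureReal_nonneg
  have hmin : min (volume.real (Q ε i)) (volume.real (Q ε i))⁻¹ ≤ 1 := by
    rcases le_total (volume.real (Q ε i)) 1 with h | h
    · exact (min_le_left _ _).trans h
    · exact (min_le_right _ _).trans (inv_le_one_of_one_le₀ h)
  calc (∫ x in Q ε i, (g t x - f x) ^ 2) ^ 2 *
        min (volume.real (Q ε i)) (volume.real (Q ε i))⁻¹
      ≤ X ^ 2 * 1 := by gcongr
    _ ≤ C ^ 2 * ε := by rw [mul_one]; exact hX2
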